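/- Notation. For $\varepsilon>0$ let $\Omega_\varepsilon=\{x\in\mathbb R^2: x_1^2\le x_2\le x_1^2+\varepsilon^2\}$. For $t\in\mathbb R$ put $P_t=(t,t^2)$. Averages over an interval $J$ are denoted by $\langle\cdot\rangle_J$. For an interval $I=[l,r]$, $l<r$, let $\mathrm{BMO}_\varepsilon(I)$ be the set of $\varphi\in L^2(I)$ with $\langle(\varphi-\langle\varphi\rangle_J)^2\rangle_J\le\varepsilon^2$ for every interval $J\subset I$ of positive length. The Bellman point of $\varphi$ is $(\langle\varphi\rangle_I,\langle\varphi^2\rangle_I)$. Conditions on $f$. The function $f:\mathbb R\to\mathbb R$ is twice continuously differentiable, $f''$ is piecewise monotone with finitely many intervals of monotonicity, and $\int_{\mathbb R}e^{-|t|/\varepsilon_\infty}\,|df''|(t)<\infty$. Tangents. Through each $x\in\Omega_\varepsilon$ there pass one right and one left tangent segment to the upper boundary (lying to the right, resp. left, of the tangency point). They meet the lower boundary at $P_u$ with the foot $u=u_R(x)=x_1+\varepsilon-\sqrt{x_1^2+\varepsilon^2-x_2}$, resp. $u=u_L(x)=x_1-\varepsilon+\sqrt{x_1^2+\varepsilon^2-x_2}$.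 Put $\sigma_R=1$, $\sigma_L=-1$. Foliation graphs. A foliation graph is a finite oriented graph whose vertices and edges carry the following figures. Edges: (E1) a tangent domain of direction $d\in\{R,L\}$: $\{x\in\Omega_\varepsilon: u_1\le u_d(x)\le u_2\}$, $-\infty\le u_1<u_2\le\infty$; it is oriented from the left border tangent to the right one if $d=R$, and from right to left if $d=L$; (E2) a chordal domain: the union of the chords $[P_{a(\ell)},P_{b(\ell)}]$, $\ell\in[\ell_0,\ell_1]$, $0\le\ell_0<\ell_1\le2\varepsilon$, where $a,b$ are continuous, $b(\ell)-a(\ell)=\ell$, and $a,b$ are differentiable with $a'<0<b'$ on $(\ell_0,\ell_1)$; it is oriented from the chord with $\ell=\ell_1$ to the chord with $\ell=\ell_0$. Vertices: (V1) a linearity domain reaching the upper boundary. Its parameters are directions $d_l,d_r\in\{R,L\}$, ends $p\le q$ in $[-\infty,\infty]$ with $p\neq\infty$, $q\neq-\infty$, and finitely many nonempty open intervals (gaps) of length at most $2\varepsilon$, pairwise disjoint, lying in $[p,q]$. Here $p$ is finite if $d_l=R$, $q$ is finite if $d_r=L$, and $q-p\ge2\varepsilon$ if $(d_l,d_r)=(L,R)$.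 The figure is the set of $x\in\Omega_\varepsilon$ with $p\le u_{d_l}(x)$, $u_{d_r}(x)\le q$, not lying strictly below the chord over any gap. The case $(L,R)$ gives multicups and long chords; $(R,R)$ and $(L,L)$ give right and left trolleybuses, multitrolleybuses and single tangents ($p=q$); $(R,L)$ gives angles ($p=q$), birdies and multibirdies. (V2) a closed linearity domain with real $p\le q$, $q-p<2\varepsilon$, and finitely many gaps in $[p,q]$ as above: the convex hull of the points $P_t$ with $t\in[p,q]$ outside the gaps (closed multicups, short chords, origins of cups). (V3) the vertices $-\infty$ and $+\infty$ for a direction $d$, with empty figure. For (V1) and (V2), let $\mathrm{arcs}$ be the set of real $t\in[p,q]$ outside all the gaps. The outgoing borders of a vertex (V1) are the chords over the gaps, the left tangent at $p$ if $d_l=L$ and $p>-\infty$, and the right tangent at $q$ if $d_r=R$ and $q<\infty$; its incoming borders are the right tangent at $p$ if $d_l=R$ and the left tangent at $q$ if $d_r=L$. The outgoing borders of (V2) are the chords over the gaps, and its incoming border is the chord $[P_p,P_q]$. The vertex $-\infty$ has one outgoing border if $d=R$ and one incoming border if $d=L$; the vertex $+\infty$ has one incoming border if $d=R$ and one outgoing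 border if $d=L$ (the corresponding ends of tangent domains with $u_1=-\infty$, resp. $u_2=+\infty$). It is required that each edge begin at an outgoing border of its source and end at an incoming border of its target; that every outgoing and every incoming border of a vertex be used by exactly one edge; that the unoriented graph be a tree (without loops and multiple edges); that the figures of all vertices and edges cover $\Omega_\varepsilon$; and that figures of distinct vertices or edges have disjoint interiors. Admissible graphs. A foliation graph is admissible for $f$ and $\varepsilon$ if there are functions $m$, one for each tangent domain, and affine functions $\beta_0+\beta_1x_1+\beta_2x_2$, one for each vertex, such that: (1) for each vertex and each $t\in\mathrm{arcs}$, $\beta_1=f'(t)-2\beta_2t$ and $\beta_0=f(t)-tf'(t)+\beta_2t^2$; for a single tangent with foot $w$ (type (V1) with $p=q=w$ and $d_l=d_r$), moreover, $\beta_2=f''(w)/2$; (2) for each chordal domain and each $\ell\in[\ell_0,\ell_1]$, $\ell>0$, with $a=a(\ell)$, $b=b(\ell)$: $\langle f'\rangle_{[a,b]}=\frac{f'(a)+f'(b)}2$, $f''(a)\le\langle f''\rangle_{[a,b]}$, and $f''(b)\le\langle f''\rangle_{[a,b]}$; (3) for each tangent domain of direction $d$, $m$ is continuous on $\{u\in\mathbb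 R:u_1\le u\le u_2\}$, and $\sigma_d\varepsilon m'+m-f'=0$, $\sigma_d m''\le0$ on $(u_1,u_2)$; if $d=R$ and $u_1=-\infty$, then $m(u)=\varepsilon^{-1}e^{-u/\varepsilon}\int_{-\infty}^uf'(t)e^{t/\varepsilon}dt$, and if $d=L$ and $u_2=+\infty$, then $m(u)=\varepsilon^{-1}e^{u/\varepsilon}\int_u^{\infty}f'(t)e^{-t/\varepsilon}dt$; (4) if a tangent domain of direction $d$ begins or ends at a vertex with coefficient $\beta_2$ along the tangent with finite foot $p$, then $m(p)=f'(p)-2\sigma_d\varepsilon\beta_2$. The Bellman candidate $B:\Omega_\varepsilon\to\mathbb R$ generated by the graph equals $\beta_0+\beta_1x_1+\beta_2x_2$ in the figure of each vertex, $m(u)(x_1-u)+f(u)$ with $u=u_d(x)$ in each tangent domain, and in each chordal domain it is affine on every chord $[P_a,P_b]$ with the values $f(a)$, $f(b)$ at its ends. Theorem. Let $f$ satisfy the conditions above for some $\varepsilon_\infty$, let $0<\varepsilon<\varepsilon_\infty$, let $\Gamma$ be a graph admissible for $f$ and $\varepsilon$, and let $B$ be the Bellman candidate generated by $\Gamma$.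 Then $B$ admits an optimizer at every point $x\in\Omega_\varepsilon$: for every interval $I=[l,r]$, $l<r$, there is a function $\varphi\in\mathrm{BMO}_\varepsilon(I)$ such that $\langle\varphi\rangle_I=x_1$, $\langle\varphi^2\rangle_I=x_2$, $f(\varphi)\in L^1(I)$, and $\langle f(\varphi)\rangle_I=B(x)$. -/

import Mathlib

open MeasureTheory Set

namespace BMOBellman

noncomputable section

/-! ### The parabolic strip, the BMO ball and optimizers -/

/-- The parabolic strip `x₁² ≤ x₂ ≤ x₁² + ε²`. -/
def strip (ε : ℝ) : Set (ℝ × ℝ) :=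
  {x | x.1 ^ 2 ≤ x.2 ∧ x.2 ≤ x.1 ^ 2 + ε ^ 2}

/-- The point of the lower (fixed) boundary over `t`. -/
def pt (t : ℝ) : ℝ × ℝ := (t, t ^ 2)

/-- `φ` belongs to the ball of radius `ε` of the space `BMO` on the interval `[l, r]`,
with the quadratic seminorm. -/
def MemBMO (ε l r : ℝ) (φ : ℝ → ℝ) : Prop :=
  MemLp φ 2 (volume.restrict (Icc l r)) ∧
    ∀ c d : ℝ, l ≤ c → c < d → d ≤ r →
      (⨍ t in c..d, (φ t - ⨍ s in c..d, φ s) ^ 2) ≤ ε ^ 2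

/-- `φ` is an optimizer for `B` at the point `x` (on the interval `[l, r]`): it lies in the
ball of `BMO`, its Bellman point is `x`, and the average of `f(φ)` exists and equals `B x`. -/
def IsOptimizer (f : ℝ → ℝ) (ε : ℝ) (B : ℝ × ℝ → ℝ) (x : ℝ × ℝ) (l r : ℝ) (φ : ℝ → ℝ) : Prop :=
  MemBMO ε l r φ ∧
    (⨍ t in l..r, φ t) = x.1 ∧
    (⨍ t in l..r, φ t ^ 2) = x.2 ∧
    IntegrableOn (fun t => f (φ t)) (Icc l r) volume ∧
    (⨍ t in l..r, f (φ t)) = B x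

/-! ### Conditions on the boundary function -/

/-- `f` is `C²` and `f''` is piecewise monotone with finitely many monotonicity intervals:
`f''` is monotone on every interval that misses a suitable finite set of points. -/
def RegularityCondition (f : ℝ → ℝ) : Prop :=
  ContDiff ℝ 2 f ∧
    ∃ s : Finset ℝ, ∀ I : Set ℝ, I.OrdConnected → Disjoint I (s : Set ℝ) →
      MonotoneOn (deriv (deriv f)) I ∨ AntitoneOn (deriv (deriv f)) I

/-- Absolute convergence of `∫ exp (-|t| / ε∞) df''(t)`; the measure `μ` is `|df''|`. -/
def SummabilityCondition (f : ℝ → ℝ) (epsInf : ℝ) : Prop :=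
  ∃ μ : Measure ℝ,
    (∀ a b : ℝ, a ≤ b → μ (Icc a b) = eVariationOn (deriv (deriv f)) (Icc a b)) ∧
    (∫⁻ t, ENNReal.ofReal (Real.exp (-|t| / epsInf)) ∂μ) < ⊤

/-! ### Tangents to the upper boundary -/

/-- Direction of a tangent: a right tangent lies to the right of its tangency point,
a left tangent lies to the left of it. -/
inductive Dir
  | R
  | L

/-- The sign attached to a direction. -/
def Dir.sgn : Dir → ℝ
  | .R => 1
  | .L => -1

/-- First coordinate of the point where the right (resp. left) tangent through `x` meets the
lower boundary: `x₁ + ε - √(x₁² + ε² - x₂)` (resp. `x₁ - ε + √(x₁² + ε² - x₂)`). -/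
def foot (d : Dir) (ε : ℝ) (x : ℝ × ℝ) : ℝ :=
  x.1 + d.sgn * (ε - Real.sqrt (x.1 ^ 2 + ε ^ 2 - x.2))

/-! ### Vertices and edges of foliation graphs -/

/-- Vertices of a foliation graph. In `free` and `closed`, the linearity domain touches the lower
boundary along the arcs obtained from `[p, q]` by removing the open intervals `gaps`.

`free dl dr p q gaps` is a linearity domain that reaches the upper boundary; it is bounded on the
left by the tangent of direction `dl` at `p` and on the right by the tangent of direction
`dr` at `q`, and from below by the chords over the gaps. Thus
* `dl = L`, `dr = R`: multicups (also a single long chord, `gaps = [(p, q)]`, `q - p = 2ε`);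
* `dl = dr = R`: right trolleybuses (`gaps = [(p, q)]`), right multitrolleybuses and single right
  tangents (`p = q`); similarly with `L`;
* `dl = R`, `dr = L`: angles (`p = q`), birdies (`gaps = [(p, q)]`) and multibirdies.

`closed p q gaps` is a linearity domain separated from the upper boundary by the chord over
`[p, q]`: closed multicups, single short chords (`gaps = [(p, q)]`), origins of cups (`p = q`).

`negInf d`, `posInf d` are the vertices at infinity for tangents of direction `d`. -/
inductive Vertex
  | free (dl dr : Dir) (p q : EReal) (gaps : List (ℝ × ℝ))
  | closed (p q : ℝ) (gaps : List (ℝ × ℝ))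
  | negInf (d : Dir)
  | posInf (d : Dir)

/-- Edges of a foliation graph: tangent domains, whose tangents have feet in `[ul, ur]`, and chordal
domains, made of the chords over `[a l, b l]`, where `l ∈ [lbot, ltop]` is the length. -/
inductive Edge
  | tangent (d : Dir) (ul ur : EReal)
  | chordal (a b : ℝ → ℝ) (lbot ltop : ℝ)

/-- Borders along which figures are glued: a tangent with a given foot (an infinite foot
stands for a vertex at infinity), or a chord. -/
inductive Border
  | tangent (d : Dir) (p : EReal)
  | chord (a b : ℝ)

/-- The gaps are nonempty, disjoint and listed from left to right between `p` and `q`; two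
neighbouring gaps may have a common endpoint (an arc may be a single point). -/
def GapChain : EReal → List (ℝ × ℝ) → EReal → Prop
  | p, [], q => p ≤ q
  | p, g :: gs, q => p ≤ (g.1 : EReal) ∧ g.1 < g.2 ∧ GapChain (g.2 : EReal) gs q

/-- Admissible numerical parameters of a vertex. -/
def Vertex.Valid (ε : ℝ) : Vertex → Prop
  | .free dl dr p q gaps =>
      p ≠ ⊤ ∧ q ≠ ⊥ ∧ GapChain p gaps q ∧ (∀ g ∈ gaps, g.2 - g.1 ≤ 2 * ε) ∧
      (dl = Dir.R → p ≠ ⊥) ∧ (dr = Dir.L → q ≠ ⊤) ∧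
      (dl = Dir.L → dr = Dir.R → p + ((2 * ε : ℝ) : EReal) ≤ q)
  | .closed p q gaps => GapChain (p : EReal) gaps (q : EReal) ∧ q - p < 2 * ε
  | .negInf _ => True
  | .posInf _ => True

/-- The set of `t` such that `pt t` belongs to the linearity domain. -/
def Vertex.arcs : Vertex → Set ℝ
  | .free _ _ p q gaps =>
      {t | p ≤ (t : EReal) ∧ (t : EReal) ≤ q ∧ ∀ g ∈ gaps, t ∉ Ioo g.1 g.2}
  | .closed p q gaps => {t | p ≤ t ∧ t ≤ q ∧ ∀ g ∈ gaps, t ∉ Ioo g.1 g.2}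
  | .negInf _ => ∅
  | .posInf _ => ∅

/-- The figure of a vertex. -/
def Vertex.region (ε : ℝ) : Vertex → Set (ℝ × ℝ)
  | .free dl dr p q gaps =>
      {x | x ∈ strip ε ∧ p ≤ (foot dl ε x : EReal) ∧ (foot dr ε x : EReal) ≤ q ∧
        ∀ g ∈ gaps, g.1 ≤ x.1 → x.1 ≤ g.2 → (g.1 + g.2) * x.1 - g.1 * g.2 ≤ x.2}
  | .closed p q gaps => convexHull ℝ (pt '' (Vertex.closed p q gaps).arcs)
  | .negInf _ => ∅
  | .posInf _ => ∅

/-- Borders of a vertex through which edges go out. -/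
def Vertex.out : Vertex → Set Border
  | .free dl dr p q gaps =>
      {β | (dl = Dir.L ∧ p ≠ ⊥ ∧ β = Border.tangent Dir.L p) ∨
        (dr = Dir.R ∧ q ≠ ⊤ ∧ β = Border.tangent Dir.R q) ∨
        ∃ g ∈ gaps, β = Border.chord g.1 g.2}
  | .closed _ _ gaps => {β | ∃ g ∈ gaps, β = Border.chord g.1 g.2}
  | .negInf .R => {Border.tangent Dir.R ⊥}
  | .negInf .L => ∅
  | .posInf .R => ∅
  | .posInf .L => {Border.tangent Dir.L ⊤}

/-- Borders of a vertex through which edges come in. -/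
def Vertex.into : Vertex → Set Border
  | .free dl dr p q _ =>
      {β | (dl = Dir.R ∧ β = Border.tangent Dir.R p) ∨
        (dr = Dir.L ∧ β = Border.tangent Dir.L q)}
  | .closed p q _ => {Border.chord p q}
  | .negInf .R => ∅
  | .negInf .L => {Border.tangent Dir.L ⊥}
  | .posInf .R => {Border.tangent Dir.R ⊤}
  | .posInf .L => ∅

/-- Admissible numerical parameters of an edge. A tangent domain has positive length. In a
chordal domain the ends of the chords are differentiable functions of the length. -/
def Edge.Valid (ε : ℝ) : Edge → Prop
  | .tangent _ ul ur => ul < ur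
  | .chordal a b lbot ltop =>
      0 ≤ lbot ∧ lbot < ltop ∧ ltop ≤ 2 * ε ∧
      (∀ l ∈ Icc lbot ltop, b l - a l = l) ∧
      ContinuousOn a (Icc lbot ltop) ∧ ContinuousOn b (Icc lbot ltop) ∧
      ∀ l ∈ Ioo lbot ltop, DifferentiableAt ℝ a l ∧ DifferentiableAt ℝ b l ∧
        deriv a l < 0 ∧ 0 < deriv b l

/-- The figure of an edge. -/
def Edge.region (ε : ℝ) : Edge → Set (ℝ × ℝ)
  | .tangent d ul ur =>
      {x | x ∈ strip ε ∧ ul ≤ (foot d ε x : EReal) ∧ (foot d ε x : EReal) ≤ ur}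
  | .chordal a b lbot ltop =>
      {x | ∃ l ∈ Icc lbot ltop, x ∈ segment ℝ (pt (a l)) (pt (b l))}

/-- The border at the beginning of an edge. Right tangent domains are oriented from left to right,
left ones from right to left, chordal domains from the upper chord to the lower one. -/
def Edge.start : Edge → Border
  | .tangent .R ul _ => Border.tangent Dir.R ul
  | .tangent .L _ ur => Border.tangent Dir.L ur
  | .chordal a b _ ltop => Border.chord (a ltop) (b ltop)

/-- The border at the end of an edge. -/
def Edge.finish : Edge → Border
  | .tangent .R _ ur => Border.tangent Dir.R ur
  | .tangent .L ul _ => Border.tangent Dir.L ul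
  | .chordal a b lbot _ => Border.chord (a lbot) (b lbot)

/-! ### Foliation graphs -/

/-- Finite oriented graphs whose vertices and edges are figures with numerical parameters. -/
structure FoliationGraph where
  nV : ℕ
  nE : ℕ
  vertex : Fin nV → Vertex
  edge : Fin nE → Edge
  src : Fin nE → Fin nV
  tgt : Fin nE → Fin nV

/-- The figure of a vertex or of an edge. -/
def FoliationGraph.region (Γ : FoliationGraph) (ε : ℝ) : Fin Γ.nV ⊕ Fin Γ.nE → Set (ℝ × ℝ)
  | .inl v => (Γ.vertex v).region ε
  | .inr e => (Γ.edge e).region ε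

/-- The graph is the graph of a foliation of the strip. -/
structure FoliationGraph.IsFoliation (Γ : FoliationGraph) (ε : ℝ) : Prop where
  vertex_valid : ∀ v, (Γ.vertex v).Valid ε
  edge_valid : ∀ e, (Γ.edge e).Valid ε
  start_mem : ∀ e, (Γ.edge e).start ∈ (Γ.vertex (Γ.src e)).out
  finish_mem : ∀ e, (Γ.edge e).finish ∈ (Γ.vertex (Γ.tgt e)).into
  out_unique : ∀ v, ∀ β ∈ (Γ.vertex v).out, ∃! e, Γ.src e = v ∧ (Γ.edge e).start = β
  into_unique : ∀ v, ∀ β ∈ (Γ.vertex v).into, ∃! e, Γ.tgt e = v ∧ (Γ.edge e).finish = β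
  no_loop : ∀ e, Γ.src e ≠ Γ.tgt e
  no_multiple : Function.Injective fun e => s(Γ.src e, Γ.tgt e)
  tree : (SimpleGraph.fromRel fun v w => ∃ e, Γ.src e = v ∧ Γ.tgt e = w).IsTree
  cover : (⋃ c, Γ.region ε c) = strip ε
  disjoint : ∀ c c', c ≠ c' → Disjoint (interior (Γ.region ε c)) (interior (Γ.region ε c'))

/-- The cup equation: `⟨f'⟩ = (f'(a) + f'(b)) / 2` over `[a, b]`. -/
def CupEquation (f : ℝ → ℝ) (a b : ℝ) : Prop :=
  (⨍ t in a..b, deriv f t) = (deriv f a + deriv f b) / 2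

/-- The left differential `f''(a) - ⟨f''⟩`. -/
def leftDifferential (f : ℝ → ℝ) (a b : ℝ) : ℝ :=
  deriv (deriv f) a - ⨍ t in a..b, deriv (deriv f) t

/-- The right differential `f''(b) - ⟨f''⟩`. -/
def rightDifferential (f : ℝ → ℝ) (a b : ℝ) : ℝ :=
  deriv (deriv f) b - ⨍ t in a..b, deriv (deriv f) t

/-- The affine function `c0 + c1 x₁ + c2 x₂`. -/
structure Affine where
  c0 : ℝ
  c1 : ℝ
  c2 : ℝ

/-- Evaluation of an affine function. -/
def Affine.eval (β : Affine) (x : ℝ × ℝ) : ℝ := β.c0 + β.c1 * x.1 + β.c2 * x.2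

/-- Conditions on the affine function of a linearity domain: at every point of the lower boundary
that lies in the domain, its trace has the value and the first derivative of `f`. On a
single tangent with foot `w` the coefficient `c2` is moreover `f''(w) / 2`. -/
def VertexConditions (f : ℝ → ℝ) (β : Affine) (v : Vertex) : Prop :=
  (∀ t ∈ v.arcs, β.c1 = deriv f t - 2 * β.c2 * t ∧
    β.c0 = f t - t * deriv f t + β.c2 * t ^ 2) ∧
  ∀ (d : Dir) (w : ℝ), v = Vertex.free d d (w : EReal) (w : EReal) [] →
    β.c2 = deriv (deriv f) w / 2

/-- Conditions on an edge; for a tangent domain `m` is the slope coefficient. -/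
def EdgeConditions (f : ℝ → ℝ) (ε : ℝ) (m : ℝ → ℝ) : Edge → Prop
  | .tangent d ul ur =>
      ContinuousOn m {u : ℝ | ul ≤ (u : EReal) ∧ (u : EReal) ≤ ur} ∧
      (∀ u : ℝ, ul < (u : EReal) → (u : EReal) < ur →
        DifferentiableAt ℝ m u ∧ d.sgn * ε * deriv m u + m u - deriv f u = 0 ∧
        d.sgn * deriv (deriv m) u ≤ 0) ∧
      (d = Dir.R → ul = ⊥ → ∀ u : ℝ, (u : EReal) ≤ ur →
        m u = ε⁻¹ * Real.exp (-u / ε) * ∫ t in Iic u, deriv f t * Real.exp (t / ε)) ∧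
      (d = Dir.L → ur = ⊤ → ∀ u : ℝ, ul ≤ (u : EReal) →
        m u = ε⁻¹ * Real.exp (u / ε) * ∫ t in Ici u, deriv f t * Real.exp (-t / ε))
  | .chordal a b lbot ltop =>
      ∀ l ∈ Icc lbot ltop, 0 < l → CupEquation f (a l) (b l) ∧
        leftDifferential f (a l) (b l) ≤ 0 ∧ rightDifferential f (a l) (b l) ≤ 0

/-- The figures of all vertices and edges satisfy their local conditions, `m` being the slope
coefficients of the tangent domains and `β` the affine functions of the linearity domains; on a
tangent with finite foot `p` that separates a tangent domain from a linearity domain,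
`m(p) = f'(p) ∓ 2 ε c2`. -/
structure FoliationGraph.LocalConditions (Γ : FoliationGraph) (f : ℝ → ℝ) (ε : ℝ)
    (m : Fin Γ.nE → ℝ → ℝ) (β : Fin Γ.nV → Affine) : Prop where
  vertex_cond : ∀ v, VertexConditions f (β v) (Γ.vertex v)
  edge_cond : ∀ e, EdgeConditions f ε (m e) (Γ.edge e)
  glue_start : ∀ e (d : Dir) (p : ℝ), (Γ.edge e).start = Border.tangent d (p : EReal) →
    m e p = deriv f p - d.sgn * (2 * ε * (β (Γ.src e)).c2)
  glue_finish : ∀ e (d : Dir) (p : ℝ), (Γ.edge e).finish = Border.tangent d (p : EReal) →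
    m e p = deriv f p - d.sgn * (2 * ε * (β (Γ.tgt e)).c2)

/-- The graph is admissible for `f` and `ε`. -/
def FoliationGraph.Admissible (Γ : FoliationGraph) (f : ℝ → ℝ) (ε : ℝ) : Prop :=
  Γ.IsFoliation ε ∧ ∃ m β, Γ.LocalConditions f ε m β

/-- `y` is the value at `x` of the function constructed in the figure of a vertex. -/
def VertexValue (ε : ℝ) (β : Affine) (v : Vertex) (x : ℝ × ℝ) (y : ℝ) : Prop :=
  x ∈ v.region ε ∧ y = β.eval x

/-- `y` is the value at `x` of the function constructed in the figure of an edge. -/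
def EdgeValue (f : ℝ → ℝ) (ε : ℝ) (m : ℝ → ℝ) : Edge → ℝ × ℝ → ℝ → Prop
  | .tangent d ul ur, x, y =>
      x ∈ (Edge.tangent d ul ur).region ε ∧
        y = m (foot d ε x) * (x.1 - foot d ε x) + f (foot d ε x)
  | .chordal a b lbot ltop, x, y =>
      ∃ l ∈ Icc lbot ltop, ∃ s ∈ Icc (0 : ℝ) 1,
        x = (1 - s) • pt (a l) + s • pt (b l) ∧ y = (1 - s) * f (a l) + s * f (b l)

/-- `B` is the function on the strip generated by the graph: at every point of the strip it is
given by the formula of a figure that contains the point (the formulas of adjacent figures agree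
on their common borders). -/
def FoliationGraph.Generates (Γ : FoliationGraph) (f : ℝ → ℝ) (ε : ℝ) (B : ℝ × ℝ → ℝ) : Prop :=
  ∃ m β, Γ.LocalConditions f ε m β ∧
    ∀ x ∈ strip ε, (∃ v, VertexValue ε (β v) (Γ.vertex v) x (B x)) ∨
      ∃ e, EdgeValue f ε (m e) (Γ.edge e) x (B x)

end

end BMOBellman

namespace BMOBellman

noncomputable section

/-! ### Concatenation of functions on the unit interval -/

/-! Optimizers are built on `[0, 1]` by concatenation. A Bellman point lies on or below the line
through `pt s` and `pt t` exactly when the average of (φ - s)(φ - t) is nonpositive, and if |t - s|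
≤ 2ε this forces the variance to be at most ((t - s)/2)² ≤ ε². The condition is linear in the
integral, hence additive over adjacent intervals. So `SmallOscillation` survives concatenation as
soon as the suffixes of the first function and the prefixes of the second lie below one common chord
of length at most 2ε (`SmallOscillation.join`).

In a linearity domain B is affine, and each x lies on a chord [`pt s`, `pt t`] of length at most 2ε
(`exists_chord_free`). It suffices to find on this chord a point left of x (`LeftPart`) and a point
right of x (`RightPart`), each with an optimizer compatible with the chord, and to concatenate
(`LeftPart.exists_piece`). On the left there are three possibilities: `pt s` belongs to the domain
and a constant serves; s lies in a gap and the chord crosses the chord over the gap, where a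
two-valued function serves; or the chord crosses an incoming right tangent with foot p, where an
optimizer for the tangency point followed by the constant p serves. The right side is the mirror
image under φ ↦ -φ(1 - ·).

Optimizers at tangency points (`Ready`) are transported through the graph. Inside a domain of right
tangents the function is continued by u + ε log t: its prefixes trace the upper boundary, and the
equation εm' + m = f' is what makes t (f - εm)(u + ε log t) an antiderivative of f(u + ε log t). A
domain coming from infinity starts with the pure logarithm, whose integrals converge because f grows
exponentially at a rate below 1/ε. At a linearity domain the tangency point of the outgoing tangent
is reached by the chord construction (`ready_out_right`). A right tangent domain depends only on
right tangent domains further left, so `ready_right` is an induction over their left ends;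
`ready_left` is its mirror image. Chordal and closed linearity domains need only functions with
values in an interval of length at most 2ε. -/

/-- The function on `[0, 1]` that runs through `ξ` on `[0, θ]` and through `η` on `[θ, 1]`. -/
def join (θ : ℝ) (ξ η : ℝ → ℝ) (t : ℝ) : ℝ :=
  if t ≤ θ then ξ (t / θ) else η ((t - θ) / (1 - θ))

lemma intervalIntegrable_comp_affine {g : ℝ → ℝ} (hg : IntervalIntegrable g volume 0 1)
    {a b : ℝ} (hab : a ≠ b) :
    IntervalIntegrable (fun t => g ((t - a) / (b - a))) volume a b := by
  have hc : b - a ≠ 0 := sub_ne_zero.2 hab.symm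
  have h := (hg.comp_mul_right (c := (b - a)⁻¹)).comp_sub_right a
  simpa [div_eq_mul_inv] using h

lemma integral_comp_affine (g : ℝ → ℝ) (a b c : ℝ) :
    ∫ t in a..(a + (b - a) * c), g ((t - a) / (b - a)) = (b - a) * ∫ t in (0 : ℝ)..c, g t := by
  rcases eq_or_ne (b - a) 0 with h | h
  · simp [h]
  · have := intervalIntegral.integral_comp_div_sub (a := a) (b := a + (b - a) * c) g h (a / (b - a))
    simp only [← sub_div] at this
    rw [this, sub_self, zero_div, add_sub_cancel_left, mul_div_cancel_left₀ _ h, smul_eq_mul]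

section join

variable {θ : ℝ} {ξ η g : ℝ → ℝ}

lemma eqOn_join_left (g : ℝ → ℝ) {c : ℝ} (hc : c ≤ θ) (h0 : 0 ≤ c) :
    EqOn (fun t => g (join θ ξ η t)) (fun t => g (ξ ((t - 0) / (θ - 0)))) (uIoc 0 c) := by
  intro t ht
  rw [uIoc_of_le h0] at ht
  simp [join, ht.2.trans hc]

lemma eqOn_join_right (g : ℝ → ℝ) {c : ℝ} (hc : θ ≤ c) :
    EqOn (fun t => g (join θ ξ η t)) (fun t => g (η ((t - θ) / (1 - θ)))) (uIoc θ c) := by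
  intro t ht
  rw [uIoc_of_le hc] at ht
  simp [join, not_le.2 ht.1]

lemma intervalIntegrable_join_left (hθ : θ ∈ Icc (0 : ℝ) 1)
    (hξ : IntervalIntegrable (fun t => g (ξ t)) volume 0 1) :
    IntervalIntegrable (fun t => g (join θ ξ η t)) volume 0 θ := by
  rcases hθ.1.eq_or_lt with h | h
  · simp [← h]
  · exact (intervalIntegrable_comp_affine hξ h.ne).congr
      (eqOn_join_left g le_rfl hθ.1).symm

lemma intervalIntegrable_join_right (hθ : θ ∈ Icc (0 : ℝ) 1)
    (hη : IntervalIntegrable (fun t => g (η t)) volume 0 1) :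
    IntervalIntegrable (fun t => g (join θ ξ η t)) volume θ 1 := by
  rcases hθ.2.eq_or_lt with h | h
  · simp [h]
  · exact (intervalIntegrable_comp_affine hη h.ne).congr
      (eqOn_join_right g hθ.2).symm

lemma intervalIntegrable_join (hθ : θ ∈ Icc (0 : ℝ) 1)
    (hξ : IntervalIntegrable (fun t => g (ξ t)) volume 0 1)
    (hη : IntervalIntegrable (fun t => g (η t)) volume 0 1) :
    IntervalIntegrable (fun t => g (join θ ξ η t)) volume 0 1 :=
  (intervalIntegrable_join_left hθ hξ).trans (intervalIntegrable_join_right hθ hη)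

lemma integral_join_left (g : ℝ → ℝ) (hθ : θ ∈ Icc (0 : ℝ) 1) {c : ℝ} (hc : c ∈ Icc (0 : ℝ) 1) :
    ∫ t in (0 : ℝ)..(θ * c), g (join θ ξ η t) = θ * ∫ t in (0 : ℝ)..c, g (ξ t) := by
  have h := integral_comp_affine (fun t => g (ξ t)) 0 θ c
  rw [zero_add, sub_zero] at h
  rw [← h]
  have := eqOn_join_left (ξ := ξ) (η := η) g (mul_le_of_le_one_right hθ.1 hc.2)
    (mul_nonneg hθ.1 hc.1)
  exact intervalIntegral.integral_congr_ae (Filter.Eventually.of_forall fun t ht => by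
    simpa using this ht)

lemma integral_join_right (hθ : θ ∈ Icc (0 : ℝ) 1)
    (hξ : IntervalIntegrable (fun t => g (ξ t)) volume 0 1)
    (hη : IntervalIntegrable (fun t => g (η t)) volume 0 1)
    {c : ℝ} (hc : c ∈ Icc (0 : ℝ) 1) :
    ∫ t in (0 : ℝ)..(θ + (1 - θ) * c), g (join θ ξ η t) =
      θ * (∫ t in (0 : ℝ)..1, g (ξ t)) + (1 - θ) * ∫ t in (0 : ℝ)..c, g (η t) := by
  have h0 : 0 ≤ 1 - θ := sub_nonneg.2 hθ.2
  have h1 : θ + (1 - θ) * c ≤ 1 := by nlinarith [hc.2]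
  have h2 : θ ≤ θ + (1 - θ) * c := le_add_of_nonneg_right (mul_nonneg h0 hc.1)
  rw [← intervalIntegral.integral_add_adjacent_intervals (b := θ)
    (intervalIntegrable_join_left hθ hξ)
    ((intervalIntegrable_join_right hθ hη).mono_set (by
      rw [uIcc_of_le h2, uIcc_of_le hθ.2]; exact Icc_subset_Icc_right h1))]
  congr 1
  · simpa using integral_join_left (ξ := ξ) (η := η) g hθ (c := 1) (by simp)
  · rw [← integral_comp_affine (fun t => g (η t)) θ 1 c]
    exact intervalIntegral.integral_congr_ae (Filter.Eventually.of_forall fun t ht =>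
      eqOn_join_right g h2 ht)

lemma integral_join (hθ : θ ∈ Icc (0 : ℝ) 1)
    (hξ : IntervalIntegrable (fun t => g (ξ t)) volume 0 1)
    (hη : IntervalIntegrable (fun t => g (η t)) volume 0 1) :
    ∫ t in (0 : ℝ)..1, g (join θ ξ η t) =
      θ * (∫ t in (0 : ℝ)..1, g (ξ t)) + (1 - θ) * ∫ t in (0 : ℝ)..1, g (η t) := by
  simpa using integral_join_right hθ hξ hη (c := 1) (by simp)

/-- Rescaling by θ or 1 - θ degenerates at the ends; there c' = 0 serves, so later arguments need no
separate cases for θ = 0 and θ = 1. -/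
lemma mem_left_or_mem_right {θ c : ℝ} (hθ : θ ∈ Icc (0 : ℝ) 1) (hc : c ∈ Icc (0 : ℝ) 1) :
    (c ≤ θ ∧ ∃ c' ∈ Icc (0 : ℝ) 1, c = θ * c') ∨
      (θ ≤ c ∧ ∃ c' ∈ Icc (0 : ℝ) 1, c = θ + (1 - θ) * c') := by
  rcases le_total c θ with h | h
  · refine Or.inl ⟨h, ?_⟩
    rcases hθ.1.eq_or_lt with h0 | h0
    · exact ⟨0, by simp, by simpa using le_antisymm (h.trans h0.ge) hc.1⟩
    · exact ⟨c / θ, ⟨div_nonneg hc.1 h0.le, (div_le_one h0).2 h⟩, by field_simp⟩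
  · refine Or.inr ⟨h, ?_⟩
    rcases hθ.2.eq_or_lt with h0 | h0
    · exact ⟨0, by simp, by simpa using le_antisymm (hc.2.trans h0.ge) h⟩
    · have h1 : 0 < 1 - θ := sub_pos.2 h0
      exact ⟨(c - θ) / (1 - θ), ⟨div_nonneg (sub_nonneg.2 h) h1.le,
        (div_le_one h1).2 (by linarith [hc.2])⟩, by field_simp; ring⟩

end join

/-! ### Moments and the oscillation condition -/

/-- The averages over `[0, 1]` of `φ`, `φ²` and `f(φ)` exist and are `x.1`, `x.2` and `V`. -/
structure Moments (f φ : ℝ → ℝ) (x : ℝ × ℝ) (V : ℝ) : Prop where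
  int1 : IntervalIntegrable φ volume 0 1
  int2 : IntervalIntegrable (fun t => φ t ^ 2) volume 0 1
  intf : IntervalIntegrable (fun t => f (φ t)) volume 0 1
  avg1 : ∫ t in (0 : ℝ)..1, φ t = x.1
  avg2 : ∫ t in (0 : ℝ)..1, φ t ^ 2 = x.2
  avgf : ∫ t in (0 : ℝ)..1, f (φ t) = V

/-- The integral over `[0, c]` of the quadratic function of `φ` that vanishes on the line
through `pt s` and `pt t`. -/
def chordIntegral (φ : ℝ → ℝ) (s t c : ℝ) : ℝ :=
  ∫ τ in (0 : ℝ)..c, (φ τ - s) * (φ τ - t)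

/-- Bellman points of subintervals lie below chords of length at most `2ε`. -/
def SmallOscillation (ε : ℝ) (φ : ℝ → ℝ) : Prop :=
  ∀ c d : ℝ, 0 ≤ c → c < d → d ≤ 1 →
    ∃ s t : ℝ, (t - s) ^ 2 ≤ (2 * ε) ^ 2 ∧ chordIntegral φ s t d ≤ chordIntegral φ s t c

/-- The Bellman points of `[c, 1]` lie below the line through `pt s` and `pt t`. -/
def SuffixBelow (s t : ℝ) (φ : ℝ → ℝ) : Prop :=
  ∀ c ∈ Icc (0 : ℝ) 1, chordIntegral φ s t 1 ≤ chordIntegral φ s t c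

/-- The Bellman points of `[0, c]` lie below the line through `pt s` and `pt t`. -/
def PrefixBelow (s t : ℝ) (φ : ℝ → ℝ) : Prop :=
  ∀ c ∈ Icc (0 : ℝ) 1, chordIntegral φ s t c ≤ 0

/-- The average over `[0, c]` does not exceed the average over `[0, 1]`. -/
def PrefixMeanLe (φ : ℝ → ℝ) (m : ℝ) : Prop :=
  ∀ c ∈ Icc (0 : ℝ) 1, ∫ t in (0 : ℝ)..c, φ t ≤ c * m

/-- A function on `[0, 1]` of small oscillation with given averages, increasing on average. -/
structure Piece (f : ℝ → ℝ) (ε : ℝ) (φ : ℝ → ℝ) (x : ℝ × ℝ) (V : ℝ) : Prop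
    extends Moments f φ x V where
  osc : SmallOscillation ε φ
  mean : PrefixMeanLe φ x.1

section moments

variable {f φ ξ η : ℝ → ℝ} {x y : ℝ × ℝ} {ε V W θ s t : ℝ}

lemma chordIntegral_eq (h1 : IntervalIntegrable φ volume 0 1)
    (h2 : IntervalIntegrable (fun t => φ t ^ 2) volume 0 1) (s t : ℝ)
    {c : ℝ} (hc : c ∈ Icc (0 : ℝ) 1) :
    chordIntegral φ s t c =
      (∫ τ in (0 : ℝ)..c, φ τ ^ 2) - (s + t) * (∫ τ in (0 : ℝ)..c, φ τ) + s * t * c := by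
  have hsub : uIcc 0 c ⊆ uIcc (0 : ℝ) 1 := by
    rw [uIcc_of_le hc.1, uIcc_of_le zero_le_one]; exact Icc_subset_Icc_right hc.2
  have h1' := h1.mono_set hsub
  have h2' := h2.mono_set hsub
  have : (fun τ => (φ τ - s) * (φ τ - t)) = fun τ => φ τ ^ 2 - (s + t) * φ τ + s * t := by
    ext; ring
  rw [chordIntegral, this, intervalIntegral.integral_add (h2'.sub (h1'.const_mul _))
    intervalIntegrable_const, intervalIntegral.integral_sub h2' (h1'.const_mul _),
    intervalIntegral.integral_const_mul, intervalIntegral.integral_const]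
  simp [mul_comm]

lemma Moments.chordIntegral_one (h : Moments f φ x V) (s t : ℝ) :
    chordIntegral φ s t 1 = x.2 - (s + t) * x.1 + s * t := by
  rw [chordIntegral_eq h.int1 h.int2 s t (by simp), h.avg1, h.avg2, mul_one]

lemma Moments.intervalIntegrable_chord (h : Moments f φ x V) (s t : ℝ) :
    IntervalIntegrable (fun τ => (φ τ - s) * (φ τ - t)) volume 0 1 := by
  have : (fun τ => (φ τ - s) * (φ τ - t)) = fun τ => φ τ ^ 2 - (s + t) * φ τ + s * t := by
    ext; ring
  rw [this]
  exact (h.int2.sub (h.int1.const_mul _)).add intervalIntegrable_const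

lemma Moments.join (hξ : Moments f ξ x V) (hη : Moments f η y W) (hθ : θ ∈ Icc (0 : ℝ) 1) :
    Moments f (join θ ξ η) (θ • x + (1 - θ) • y) (θ * V + (1 - θ) * W) where
  int1 := intervalIntegrable_join (g := id) hθ hξ.int1 hη.int1
  int2 := intervalIntegrable_join (g := fun v => v ^ 2) hθ hξ.int2 hη.int2
  intf := intervalIntegrable_join (g := f) hθ hξ.intf hη.intf
  avg1 := by
    have := integral_join (g := id) hθ hξ.int1 hη.int1
    simpa [hξ.avg1, hη.avg1] using this
  avg2 := by
    have := integral_join (g := fun v => v ^ 2) hθ hξ.int2 hη.int2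
    simpa [hξ.avg2, hη.avg2] using this
  avgf := by rw [integral_join hθ hξ.intf hη.intf, hξ.avgf, hη.avgf]

lemma chordIntegral_join_left (ξ η : ℝ → ℝ) (s t : ℝ) (hθ : θ ∈ Icc (0 : ℝ) 1)
    {c : ℝ} (hc : c ∈ Icc (0 : ℝ) 1) :
    chordIntegral (BMOBellman.join θ ξ η) s t (θ * c) = θ * chordIntegral ξ s t c :=
  integral_join_left (fun v => (v - s) * (v - t)) hθ hc

lemma chordIntegral_join_right (hξ : Moments f ξ x V) (hη : Moments f η y W)
    (hθ : θ ∈ Icc (0 : ℝ) 1) (s t : ℝ) {c : ℝ} (hc : c ∈ Icc (0 : ℝ) 1) :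
    chordIntegral (BMOBellman.join θ ξ η) s t (θ + (1 - θ) * c) =
      θ * chordIntegral ξ s t 1 + (1 - θ) * chordIntegral η s t c :=
  integral_join_right (g := fun v => (v - s) * (v - t)) hθ (hξ.intervalIntegrable_chord s t)
    (hη.intervalIntegrable_chord s t) hc

lemma chordIntegral_join_one (hξ : Moments f ξ x V) (hη : Moments f η y W)
    (hθ : θ ∈ Icc (0 : ℝ) 1) (s t : ℝ) :
    chordIntegral (BMOBellman.join θ ξ η) s t 1 =
      θ * chordIntegral ξ s t 1 + (1 - θ) * chordIntegral η s t 1 := by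
  simpa using chordIntegral_join_right hξ hη hθ s t (c := 1) (by simp)

/-- Only intervals that straddle the junction are new. Such an interval is a suffix of ξ followed by
a prefix of η, and the common line bounds both contributions by zero. -/
lemma SmallOscillation.join (hξm : Moments f ξ x V) (hηm : Moments f η y W)
    (hξ : SmallOscillation ε ξ) (hη : SmallOscillation ε η) (hθ : θ ∈ Icc (0 : ℝ) 1)
    (hst : (t - s) ^ 2 ≤ (2 * ε) ^ 2) (hs : SuffixBelow s t ξ) (hp : PrefixBelow s t η) :
    SmallOscillation ε (join θ ξ η) := by
  intro c d hc hcd hd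
  have h0 : 0 ≤ 1 - θ := sub_nonneg.2 hθ.2
  rcases mem_left_or_mem_right hθ ⟨hc, hcd.le.trans hd⟩ with ⟨hcθ, c', hc', rfl⟩ | ⟨hcθ, c', hc', rfl⟩
  · rcases mem_left_or_mem_right hθ ⟨hc.trans hcd.le, hd⟩ with
      ⟨hdθ, d', hd', rfl⟩ | ⟨hdθ, d', hd', rfl⟩
    · obtain ⟨s', t', h, h'⟩ := hξ c' d' hc'.1 (lt_of_mul_lt_mul_left hcd hθ.1) hd'.2
      refine ⟨s', t', h, ?_⟩
      rw [chordIntegral_join_left ξ η s' t' hθ hc', chordIntegral_join_left ξ η s' t' hθ hd']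
      exact mul_le_mul_of_nonneg_left h' hθ.1
    · refine ⟨s, t, hst, ?_⟩
      rw [chordIntegral_join_left ξ η s t hθ hc', chordIntegral_join_right hξm hηm hθ s t hd']
      have h1 := mul_le_mul_of_nonneg_left (hs c' hc') hθ.1
      have h2 := mul_le_mul_of_nonneg_left (hp d' hd') h0
      linarith
  · rcases mem_left_or_mem_right hθ ⟨hc.trans hcd.le, hd⟩ with
      ⟨hdθ, -⟩ | ⟨hdθ, d', hd', rfl⟩
    · exact absurd (hcd.trans_le hdθ) (not_lt.2 hcθ)
    · have hlt : c' < d' := by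
        have : (1 - θ) * c' < (1 - θ) * d' := by linarith
        exact lt_of_mul_lt_mul_left this h0
      obtain ⟨s', t', h, h'⟩ := hη c' d' hc'.1 hlt hd'.2
      refine ⟨s', t', h, ?_⟩
      rw [chordIntegral_join_right hξm hηm hθ s' t' hc', chordIntegral_join_right hξm hηm hθ s' t' hd']
      have := mul_le_mul_of_nonneg_left h' h0
      linarith

/-- Since x.1 ≤ y.1, a prefix ending in ξ has mean at most x.1, which is below the total mean, while
a prefix ending in η gives too little weight to the larger values. -/
lemma PrefixMeanLe.join (hξm : Moments f ξ x V) (hηm : Moments f η y W)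
    (hξ : PrefixMeanLe ξ x.1) (hη : PrefixMeanLe η y.1) (hθ : θ ∈ Icc (0 : ℝ) 1)
    (hxy : x.1 ≤ y.1) :
    PrefixMeanLe (join θ ξ η) (θ • x + (1 - θ) • y).1 := by
  intro c hc
  have h0 : 0 ≤ 1 - θ := sub_nonneg.2 hθ.2
  have e : (θ • x + (1 - θ) • y).1 = θ * x.1 + (1 - θ) * y.1 := by simp
  rw [e]
  rcases mem_left_or_mem_right hθ hc with ⟨hcθ, c', hc', rfl⟩ | ⟨hcθ, c', hc', rfl⟩
  · have := integral_join_left (ξ := ξ) (η := η) (fun v => v) hθ hc'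
    rw [this]
    have h1 := mul_le_mul_of_nonneg_left (hξ c' hc') hθ.1
    have h2 : 0 ≤ (θ * c') * ((1 - θ) * (y.1 - x.1)) := mul_nonneg (mul_nonneg hθ.1 hc'.1)
      (mul_nonneg h0 (sub_nonneg.2 hxy))
    linarith
  · have := integral_join_right (g := fun v => v) hθ hξm.int1 hηm.int1 hc'
    rw [this, hξm.avg1]
    have h1 := mul_le_mul_of_nonneg_left (hη c' hc') h0
    have h2 : 0 ≤ (1 - c') * ((1 - θ) * (θ * (y.1 - x.1))) :=
      mul_nonneg (sub_nonneg.2 hc'.2) (mul_nonneg h0 (mul_nonneg hθ.1 (sub_nonneg.2 hxy)))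
    linarith

lemma Piece.join (hξ : Piece f ε ξ x V) (hη : Piece f ε η y W) (hθ : θ ∈ Icc (0 : ℝ) 1)
    (hst : (t - s) ^ 2 ≤ (2 * ε) ^ 2) (hs : SuffixBelow s t ξ) (hp : PrefixBelow s t η)
    (hxy : x.1 ≤ y.1) :
    Piece f ε (join θ ξ η) (θ • x + (1 - θ) • y) (θ * V + (1 - θ) * W) where
  toMoments := hξ.toMoments.join hη.toMoments hθ
  osc := hξ.osc.join hξ.toMoments hη.toMoments hη.osc hθ hst hs hp
  mean := hξ.mean.join hξ.toMoments hη.toMoments hη.mean hθ hxy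

lemma SuffixBelow.join (hξm : Moments f ξ x V) (hηm : Moments f η y W) (hθ : θ ∈ Icc (0 : ℝ) 1)
    (hξ : SuffixBelow s t ξ) (hη : SuffixBelow s t η) (h1 : chordIntegral η s t 1 ≤ 0) :
    SuffixBelow s t (join θ ξ η) := by
  intro c hc
  have h0 : 0 ≤ 1 - θ := sub_nonneg.2 hθ.2
  rw [chordIntegral_join_one hξm hηm hθ]
  rcases mem_left_or_mem_right hθ hc with ⟨hcθ, c', hc', rfl⟩ | ⟨hcθ, c', hc', rfl⟩
  · rw [chordIntegral_join_left ξ η s t hθ hc']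
    have h2 := mul_le_mul_of_nonneg_left (hξ c' hc') hθ.1
    have h3 := mul_le_mul_of_nonneg_left h1 h0
    linarith
  · rw [chordIntegral_join_right hξm hηm hθ s t hc']
    have h2 := mul_le_mul_of_nonneg_left (hη c' hc') h0
    linarith

lemma chordIntegral_const (v s t c : ℝ) :
    chordIntegral (fun _ => v) s t c = c * ((v - s) * (v - t)) := by
  rw [chordIntegral, intervalIntegral.integral_const, sub_zero, smul_eq_mul]

lemma Moments.const (f : ℝ → ℝ) (v : ℝ) : Moments f (fun _ => v) (pt v) (f v) where
  int1 := intervalIntegrable_const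
  int2 := intervalIntegrable_const
  intf := intervalIntegrable_const
  avg1 := by simp [pt]
  avg2 := by simp [pt]
  avgf := by simp

lemma Piece.const (f : ℝ → ℝ) (ε v : ℝ) : Piece f ε (fun _ => v) (pt v) (f v) where
  toMoments := Moments.const f v
  osc := fun c d _ _ _ => ⟨v, v, by simpa using sq_nonneg (2 * ε), by simp [chordIntegral_const]⟩
  mean := fun c _ => by simp [pt]

lemma suffixBelow_const {v : ℝ} (h : (v - s) * (v - t) ≤ 0) : SuffixBelow s t (fun _ => v) := by
  intro c hc
  rw [chordIntegral_const, chordIntegral_const]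
  nlinarith [hc.2]

lemma prefixBelow_const {v : ℝ} (h : (v - s) * (v - t) ≤ 0) : PrefixBelow s t (fun _ => v) := by
  intro c hc
  rw [chordIntegral_const]
  exact mul_nonpos_of_nonneg_of_nonpos hc.1 h

/-- A function with prefixes above a line followed by a constant below it. -/
lemma suffixBelow_join_const (hξ : Moments f ξ x V) (hθ : θ ∈ Icc (0 : ℝ) 1) {v : ℝ}
    (hpre : ∀ c ∈ Icc (0 : ℝ) 1, 0 ≤ chordIntegral ξ s t c) (hv : (v - s) * (v - t) ≤ 0)
    (htot : chordIntegral (join θ ξ fun _ => v) s t 1 ≤ 0) :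
    SuffixBelow s t (join θ ξ fun _ => v) := by
  intro c hc
  have h0 : 0 ≤ 1 - θ := sub_nonneg.2 hθ.2
  rcases mem_left_or_mem_right hθ hc with ⟨hcθ, c', hc', rfl⟩ | ⟨hcθ, c', hc', rfl⟩
  · rw [chordIntegral_join_left _ _ s t hθ hc']
    exact htot.trans (mul_nonneg hθ.1 (hpre c' hc'))
  · rw [chordIntegral_join_one hξ (Moments.const f v) hθ,
      chordIntegral_join_right hξ (Moments.const f v) hθ s t hc', chordIntegral_const,
      chordIntegral_const]
    have := mul_nonneg (mul_nonneg h0 (sub_nonneg.2 hc'.2)) (neg_nonneg.2 hv)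
    linarith

end moments

/-! ### Reflection -/

/-- The reflected function `t ↦ -φ (1 - t)`. -/
def reflect (φ : ℝ → ℝ) (t : ℝ) : ℝ := -φ (1 - t)

section reflect

variable {f φ : ℝ → ℝ} {x : ℝ × ℝ} {ε V s t m : ℝ}

lemma integral_comp_one_sub {g : ℝ → ℝ} (hg : IntervalIntegrable g volume 0 1)
    {c : ℝ} (hc : c ∈ Icc (0 : ℝ) 1) :
    ∫ t in (0 : ℝ)..c, g (1 - t) = (∫ t in (0 : ℝ)..1, g t) - ∫ t in (0 : ℝ)..(1 - c), g t := by
  rw [intervalIntegral.integral_comp_sub_left (fun t => g t), sub_zero, eq_sub_iff_add_eq, add_comm]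
  refine intervalIntegral.integral_add_adjacent_intervals (hg.mono_set ?_) (hg.mono_set ?_) <;>
  · rw [uIcc_of_le (by linarith [hc.1, hc.2]), uIcc_of_le zero_le_one]
    exact Icc_subset_Icc (by linarith [hc.1, hc.2]) (by linarith [hc.1, hc.2])

lemma intervalIntegrable_comp_one_sub {g : ℝ → ℝ} (hg : IntervalIntegrable g volume 0 1) :
    IntervalIntegrable (fun t => g (1 - t)) volume 0 1 := by
  simpa using (hg.comp_sub_left 1).symm

lemma Moments.reflect (h : Moments f φ x V) :
    Moments (fun v => f (-v)) (reflect φ) (-x.1, x.2) V where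
  int1 := (intervalIntegrable_comp_one_sub h.int1).neg
  int2 := by simpa [BMOBellman.reflect] using intervalIntegrable_comp_one_sub h.int2
  intf := by simpa [BMOBellman.reflect] using intervalIntegrable_comp_one_sub h.intf
  avg1 := by
    simp [BMOBellman.reflect, ← h.avg1]
  avg2 := by
    have := integral_comp_one_sub h.int2 (c := 1) (by simp)
    simpa [BMOBellman.reflect, h.avg2] using this
  avgf := by
    have := integral_comp_one_sub h.intf (c := 1) (by simp)
    simpa [BMOBellman.reflect, h.avgf] using this

lemma Moments.chordIntegral_reflect (h : Moments f φ x V) (s t : ℝ)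
    {c : ℝ} (hc : c ∈ Icc (0 : ℝ) 1) :
    chordIntegral (BMOBellman.reflect φ) s t c =
      chordIntegral φ (-t) (-s) 1 - chordIntegral φ (-t) (-s) (1 - c) := by
  rw [chordIntegral, chordIntegral, chordIntegral,
    ← integral_comp_one_sub (h.intervalIntegrable_chord (-t) (-s)) hc]
  congr 1
  ext τ
  simp only [BMOBellman.reflect]
  ring

lemma one_sub_mem {c : ℝ} (hc : c ∈ Icc (0 : ℝ) 1) : 1 - c ∈ Icc (0 : ℝ) 1 :=
  ⟨sub_nonneg.2 hc.2, sub_le_self _ hc.1⟩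

/-- Monotonicity of means is preserved: a prefix of the reflection is a negated suffix of φ, and
suffix means are at least the total mean because prefix means are at most it. -/
lemma Piece.reflect (h : Piece f ε φ x V) :
    Piece (fun v => f (-v)) ε (reflect φ) (-x.1, x.2) V where
  toMoments := h.toMoments.reflect
  osc := by
    intro c d hc hcd hd
    obtain ⟨s, t, hst, hle⟩ := h.osc (1 - d) (1 - c) (by linarith) (by linarith) (by linarith)
    refine ⟨-t, -s, by linarith [show (-s - -t) ^ 2 = (t - s) ^ 2 by ring], ?_⟩
    rw [h.chordIntegral_reflect _ _ ⟨hc, hcd.le.trans hd⟩,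
      h.chordIntegral_reflect _ _ ⟨hc.trans hcd.le, hd⟩, neg_neg, neg_neg]
    linarith
  mean := by
    intro c hc
    have h1 := integral_comp_one_sub h.int1 hc
    have h2 := h.mean (1 - c) (one_sub_mem hc)
    simp only [BMOBellman.reflect, intervalIntegral.integral_neg, h1, h.avg1]
    linarith

lemma SuffixBelow.reflect (hm : Moments f φ x V) (h : SuffixBelow s t φ) :
    PrefixBelow (-t) (-s) (reflect φ) := by
  intro c hc
  rw [hm.chordIntegral_reflect _ _ hc, neg_neg, neg_neg]
  linarith [h (1 - c) (one_sub_mem hc)]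

lemma PrefixBelow.reflect (hm : Moments f φ x V) (h : PrefixBelow s t φ) :
    SuffixBelow (-t) (-s) (reflect φ) := by
  intro c hc
  rw [hm.chordIntegral_reflect _ _ hc, hm.chordIntegral_reflect _ _ (by simp), neg_neg, neg_neg,
    sub_self]
  have := h (1 - c) (one_sub_mem hc)
  simp only [chordIntegral, intervalIntegral.integral_same] at *
  linarith

end reflect

/-! ### Optimizers on the tangents to the upper boundary -/

/-- The point of the upper boundary that lies on the right tangent with foot `p`. -/
def upperPt (ε p : ℝ) : ℝ × ℝ := (p - ε, (p - ε) ^ 2 + ε ^ 2)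

/-- There is a function with values below the right tangent with foot `p` whose Bellman
point is the tangency point. -/
def Ready (f : ℝ → ℝ) (ε p V : ℝ) : Prop :=
  ∃ ψ, Piece f ε ψ (upperPt ε p) V ∧ SuffixBelow (p - 2 * ε) p ψ

/-- The chord through `pt s` and `pt t` carries, not to the right of `x₁`, the Bellman point of a
function with suffixes below the chord. -/
def LeftPart (f : ℝ → ℝ) (ε : ℝ) (β : Affine) (s t x₁ : ℝ) : Prop :=
  ∃ y φ, Piece f ε φ y (β.eval y) ∧ SuffixBelow s t φ ∧ y.2 = (s + t) * y.1 - s * t ∧ y.1 ≤ x₁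

/-- The chord through `pt s` and `pt t` carries, not to the left of `x₁`, the Bellman point of a
function with prefixes below the chord. -/
def RightPart (f : ℝ → ℝ) (ε : ℝ) (β : Affine) (s t x₁ : ℝ) : Prop :=
  ∃ y φ, Piece f ε φ y (β.eval y) ∧ PrefixBelow s t φ ∧ y.2 = (s + t) * y.1 - s * t ∧ x₁ ≤ y.1

/-- The affine function reflected in the vertical axis. -/
def Affine.reflect (β : Affine) : Affine := ⟨β.c0, -β.c1, β.c2⟩

section parts

variable {f : ℝ → ℝ} {ε p q s t x₁ V : ℝ} {β : Affine} {x y : ℝ × ℝ}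

lemma Affine.eval_reflect (β : Affine) (x : ℝ × ℝ) :
    β.reflect.eval x = β.eval (-x.1, x.2) := by
  simp [Affine.eval, Affine.reflect]

lemma Affine.eval_combo (β : Affine) (x y : ℝ × ℝ) (θ : ℝ) :
    β.eval (θ • x + (1 - θ) • y) = θ * β.eval x + (1 - θ) * β.eval y := by
  simp [Affine.eval]; ring

lemma Piece.congr {φ : ℝ → ℝ} {V W : ℝ} (h : Piece f ε φ x V) (hx : x = y) (hV : V = W) :
    Piece f ε φ y W := hx ▸ hV ▸ h

lemma LeftPart.reflect (h : LeftPart (fun v => f (-v)) ε β.reflect (-t) (-s) (-x₁)) :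
    RightPart f ε β s t x₁ := by
  obtain ⟨y, φ, hφ, hs, hy, hx⟩ := h
  refine ⟨(-y.1, y.2), BMOBellman.reflect φ, ?_, ?_, ?_, ?_⟩
  · have := hφ.reflect
    simp only [neg_neg] at this
    exact this.congr rfl (Affine.eval_reflect β y)
  · simpa using hs.reflect hφ.toMoments
  · simp only [hy]; ring
  · simp only; linarith

lemma RightPart.reflect (h : RightPart f ε β s t x₁) :
    LeftPart (fun v => f (-v)) ε β.reflect (-t) (-s) (-x₁) := by
  obtain ⟨y, φ, hφ, hs, hy, hx⟩ := h
  refine ⟨(-y.1, y.2), BMOBellman.reflect φ, ?_, ?_, ?_, ?_⟩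
  · exact hφ.reflect.congr rfl (by simp [Affine.eval_reflect])
  · exact hs.reflect hφ.toMoments
  · simp only [hy]; ring
  · simp only; linarith

/-- The two Bellman points lie on the same chord on either side of x, and that chord itself is the
common line required for concatenation. -/
lemma LeftPart.exists_piece (hl : LeftPart f ε β s t x.1) (hr : RightPart f ε β s t x.1)
    (hst : (t - s) ^ 2 ≤ (2 * ε) ^ 2) (hx : x.2 = (s + t) * x.1 - s * t) :
    ∃ φ, Piece f ε φ x (β.eval x) := by
  obtain ⟨y, φ, hφ, hs, hy, hyx⟩ := hl
  obtain ⟨z, χ, hχ, hp, hz, hzx⟩ := hr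
  rcases (hyx.trans hzx).eq_or_lt with h | h
  · have : y = x := by
      have h1 : y.1 = x.1 := le_antisymm hyx (hzx.trans h.ge)
      exact Prod.ext h1 (by rw [hx, hy, h1])
    exact ⟨φ, this ▸ hφ⟩
  · have h0 : 0 < z.1 - y.1 := sub_pos.2 h
    set θ := (z.1 - x.1) / (z.1 - y.1) with hθ
    have e : θ * (z.1 - y.1) = z.1 - x.1 := by rw [hθ]; field_simp
    have hθ' : θ ∈ Icc (0 : ℝ) 1 := ⟨div_nonneg (sub_nonneg.2 hzx) h0.le,
      (div_le_one h0).2 (by linarith)⟩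
    have ex : θ • y + (1 - θ) • z = x := by
      refine Prod.ext ?_ ?_
      · simp; linarith
      · simp only [Prod.snd_add, Prod.smul_snd, smul_eq_mul, hx, hy, hz]
        linear_combination -(s + t) * e
    exact ⟨join θ φ χ, (hφ.join hχ hθ' hst hs hp h.le).congr ex (by rw [← ex, β.eval_combo])⟩

lemma leftPart_of_arc (hs : f s = β.eval (pt s)) (hx : s ≤ x₁) : LeftPart f ε β s t x₁ :=
  ⟨pt s, fun _ => s, (Piece.const f ε s).congr rfl hs, suffixBelow_const (by simp),
    by simp [pt]; ring, hx⟩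

/-- The chord over the gap separates `pt s` from the domain, so the chord towards x crosses it. At
the crossing point the function equal to a and then b is used: `pt a` is above the line through `pt
s`, `pt t` and `pt b` is not, so all its suffixes are below. -/
lemma leftPart_of_gap {a b : ℝ} (ha : f a = β.eval (pt a)) (hb : f b = β.eval (pt b))
    (hab : b - a ≤ 2 * ε) (has : a < s) (hsb : s < b) (hsx : s ≤ x₁) (hxt : x₁ ≤ t)
    (hx : x₁ ≤ b → (a + b) * x₁ - a * b ≤ (s + t) * x₁ - s * t) :
    LeftPart f ε β s t x₁ := by
  -- If t < b, the chord over [s, t] would run strictly below the chord over the gap, contrary to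
  -- the position of x.
  have hbt : b ≤ t := by
    by_contra! htb
    have h := hx (hxt.trans htb.le)
    have h1 : 0 < (s - a) * (b - s) := mul_pos (by linarith) (by linarith)
    have h2 : 0 < (t - a) * (b - t) := mul_pos (by linarith) (by linarith)
    rcases (hsx.trans hxt).eq_or_lt with h3 | h3
    · have : x₁ = s := le_antisymm (hxt.trans h3.ge) hsx
      subst this; subst h3; nlinarith
    · nlinarith [mul_nonneg (sub_nonneg.2 hsx) h2.le, mul_nonneg (sub_nonneg.2 hxt) h1.le,
        mul_pos (sub_pos.2 h3) h1]
  -- `A` is the height of `pt a` above the line through `pt s`, `pt t`, and `C` the depth of `pt b`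
  -- below it; θ balances them, θ A = (1 - θ) C.
  set A := (a - s) * (a - t) with hA
  set C := (b - s) * (t - b) with hC
  have hA0 : 0 < A := mul_pos_of_neg_of_neg (by linarith) (by linarith)
  have hC0 : 0 ≤ C := mul_nonneg (by linarith) (by linarith)
  have hAC : 0 < A + C := by linarith
  set θ := C / (A + C) with hθ
  have e : θ * (A + C) = C := by rw [hθ]; field_simp
  have hθ' : θ ∈ Icc (0 : ℝ) 1 := ⟨div_nonneg hC0 hAC.le, (div_le_one hAC).2 (by linarith)⟩
  have hm := (Moments.const f a).join (Moments.const f b) hθ'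
  have hy : (θ • pt a + (1 - θ) • pt b).2 =
      (s + t) * (θ • pt a + (1 - θ) • pt b).1 - s * t := by
    simp [pt]; linear_combination e
  refine ⟨θ • pt a + (1 - θ) • pt b, join θ (fun _ => a) fun _ => b, ?_, ?_, hy, ?_⟩
  · refine ((Piece.const f ε a).join (Piece.const f ε b) (s := a) (t := b) hθ' ?_
      (suffixBelow_const (by simp)) (prefixBelow_const (by simp)) ?_).congr rfl ?_
    · exact pow_le_pow_left₀ (by linarith) hab 2
    · simp [pt]; linarith
    · rw [β.eval_combo, ha, hb]
  · refine suffixBelow_join_const (Moments.const f a) hθ' (fun c hc => ?_) ?_ ?_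
    · rw [chordIntegral_const]; exact mul_nonneg hc.1 hA0.le
    · exact mul_nonpos_of_nonneg_of_nonpos (by linarith) (by linarith)
    · rw [hm.chordIntegral_one, hy]; linarith
  · have e1 : (θ • pt a + (1 - θ) • pt b).1 = θ * a + (1 - θ) * b := by simp [pt]
    rw [e1]
    rcases le_total x₁ b with h | h
    · have h1 := hx h
      have h2 : 0 < (s - a) * (b - s) := mul_pos (by linarith) (by linarith)
      -- The line through `pt s`, `pt t` minus the line over the gap is affine: negative at s,
      -- nonnegative at x₁, zero at the crossing `z`. Hence s ≤ x₁ < `z` is impossible.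
      by_contra! h3
      set z := θ * a + (1 - θ) * b with hz
      have h4 : (a + b) * z - a * b = (s + t) * z - s * t := by rw [hz]; linear_combination e
      have h5 : 0 < (s + t - a - b) * (s - z) := by nlinarith
      have h6 : 0 ≤ (s + t - a - b) * (x₁ - z) := by nlinarith
      nlinarith
    · nlinarith [hθ'.1]

/-- The tangency point lies on the tangent line, so the integral over [0, 1] vanishes; suffixes
below the line then mean prefixes above it. -/
lemma ready_prefix {ψ : ℝ → ℝ} (hψ : Piece f ε ψ (upperPt ε p) V)
    (hs : SuffixBelow (p - 2 * ε) p ψ) {c : ℝ} (hc : c ∈ Icc (0 : ℝ) 1) :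
    0 ≤ chordIntegral ψ (p - 2 * ε) p c := by
  refine le_trans (le_of_eq ?_) (hs c hc)
  rw [hψ.chordIntegral_one]; simp [upperPt]; ring

/-- The chord crosses the tangent segment between its tangency point and `pt p`; ψ followed by the
constant p has the crossing point as its Bellman point. Hypothesis `hD` says that the chord, at x₁,
is not below the tangent line. -/
lemma leftPart_of_ready (hε : 0 < ε) (hp : Ready f ε p (β.eval (upperPt ε p)))
    (hfp : f p = β.eval (pt p)) (hsp : s ≤ p) (hpt : p ≤ t) (hst : t - s ≤ 2 * ε)
    (hx : p - ε ≤ x₁) (hD : (x₁ - s) * (x₁ - t) ≤ (x₁ - p) * (x₁ - p + 2 * ε)) :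
    LeftPart f ε β s t x₁ := by
  obtain ⟨ψ, hψ, hs⟩ := hp
  -- `A` is the height of the tangency point above the chord line, `C` the depth of `pt p` below it,
  -- and `k` the difference of the slopes of the chord and the tangent; the horizontal distance ε
  -- gives `A + C = k * ε`.
  set A := (p - ε - s) * (p - ε - t) + ε ^ 2 with hA
  set C := (p - s) * (t - p) with hC
  set k := s + t - 2 * p + 2 * ε with hk
  have hA0 : 0 ≤ A := by nlinarith [sq_nonneg (p - ε - s + (p - ε - t))]
  have hC0 : 0 ≤ C := mul_nonneg (by linarith) (by linarith)
  have hkε : A + C = k * ε := by rw [hA, hC, hk]; ring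
  have hk0 : 0 ≤ k := by
    by_contra! h
    nlinarith
  have hDx : A ≤ k * (x₁ - (p - ε)) := by rw [hA, hk]; linarith
  obtain ⟨θ, hθ, e, hy1⟩ : ∃ θ ∈ Icc (0 : ℝ) 1, θ * (A + C) = C ∧ p - ε * θ ≤ x₁ := by
    rcases hk0.eq_or_lt with h | h
    -- Equal slopes force `A = C = 0`: the chord lies on the tangent line and the tangency point
    -- itself is taken.
    · rw [← h, zero_mul] at hkε
      exact ⟨1, by simp, by linarith, by linarith⟩
    · have h1 : 0 < A + C := by rw [hkε]; positivity
      have e : C / (A + C) * (A + C) = C := by field_simp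
      refine ⟨C / (A + C), ⟨by positivity, (div_le_one h1).2 (by linarith)⟩, e, ?_⟩
      rw [hkε] at e ⊢
      have : 0 ≤ k * (x₁ - (p - ε * (C / (k * ε)))) := by linarith
      linarith [nonneg_of_mul_nonneg_right this h]
  have hm := hψ.toMoments.join (Moments.const f p) hθ
  have hy : (θ • upperPt ε p + (1 - θ) • pt p).2 =
      (s + t) * (θ • upperPt ε p + (1 - θ) • pt p).1 - s * t := by
    simp [pt, upperPt]; linear_combination e
  refine ⟨θ • upperPt ε p + (1 - θ) • pt p, join θ ψ fun _ => p, ?_, ?_, hy, ?_⟩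
  · refine (hψ.join (Piece.const f ε p) (s := p - 2 * ε) (t := p) hθ (by apply le_of_eq; ring) hs
      (prefixBelow_const (by simp)) ?_).congr rfl ?_
    · simp [pt, upperPt, hε.le]
    · rw [β.eval_combo, hfp]
  · refine suffixBelow_join_const hψ.toMoments hθ (fun c hc => ?_) ?_ ?_
    -- Prefixes of ψ are above the tangent line and their means are at most p - ε. The chord line is
    -- steeper and passes below the tangency point, so to the left of p - ε it stays below the
    -- tangent line. This is where the monotonicity of means enters.
    · have h1 := ready_prefix hψ hs hc
      have h2 := hψ.mean c hc
      rw [chordIntegral_eq hψ.int1 hψ.int2 _ _ hc] at h1 ⊢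
      simp only [upperPt] at h2
      have h3 := mul_nonneg hk0 (sub_nonneg.2 h2)
      have h4 := mul_nonneg hc.1 hA0
      rw [hk] at h3; rw [hA] at h4
      linarith
    · exact mul_nonpos_of_nonneg_of_nonpos (by linarith) (by linarith)
    · rw [hm.chordIntegral_one, hy]; linarith
  · simp [pt, upperPt]; linarith

lemma rightPart_of_arc (ht : f t = β.eval (pt t)) (hx : x₁ ≤ t) : RightPart f ε β s t x₁ :=
  LeftPart.reflect (leftPart_of_arc (by simpa [Affine.eval_reflect, pt] using ht) (by linarith))

lemma rightPart_of_gap {a b : ℝ} (ha : f a = β.eval (pt a)) (hb : f b = β.eval (pt b))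
    (hab : b - a ≤ 2 * ε) (hat : a < t) (htb : t < b) (hsx : s ≤ x₁) (hxt : x₁ ≤ t)
    (hx : a ≤ x₁ → (a + b) * x₁ - a * b ≤ (s + t) * x₁ - s * t) :
    RightPart f ε β s t x₁ := by
  refine LeftPart.reflect (leftPart_of_gap (a := -b) (b := -a) ?_ ?_ ?_ ?_ ?_ ?_ ?_ ?_)
  · simpa [Affine.eval_reflect, pt] using hb
  · simpa [Affine.eval_reflect, pt] using ha
  all_goals try linarith
  intro h
  have := hx (by linarith)
  linarith

lemma rightPart_of_ready (hε : 0 < ε)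
    (hq : Ready (fun v => f (-v)) ε (-q) (β.eval (q + ε, (q + ε) ^ 2 + ε ^ 2)))
    (hfq : f q = β.eval (pt q)) (hsq : s ≤ q) (hqt : q ≤ t) (hst : t - s ≤ 2 * ε)
    (hx : x₁ ≤ q + ε) (hD : (x₁ - s) * (x₁ - t) ≤ (x₁ - q) * (x₁ - q - 2 * ε)) :
    RightPart f ε β s t x₁ := by
  refine LeftPart.reflect (leftPart_of_ready (p := -q) hε ?_ ?_ ?_ ?_ ?_ ?_ ?_)
  · convert hq using 1
    rw [Affine.eval_reflect, upperPt]
    simp only [Affine.eval]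
    ring
  · simpa [Affine.eval_reflect, pt] using hfq
  all_goals linarith

/-- The line through `pt (q - 2 * ε)` and `pt q` is the tangent. From a point of it left of the
tangency point, appending the constant q moves the Bellman point along the tangent towards `pt q`;
the weight is chosen to stop at the tangency point. -/
lemma LeftPart.ready (hε : 0 < ε) (hfq : f q = β.eval (pt q))
    (h : LeftPart f ε β (q - 2 * ε) q (q - ε)) : Ready f ε q (β.eval (upperPt ε q)) := by
  obtain ⟨y, φ, hφ, hs, hy, hyx⟩ := h
  have h0 : 0 < q - y.1 := by linarith
  set θ := ε / (q - y.1) with hθ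
  have e : θ * (q - y.1) = ε := by rw [hθ]; field_simp
  have hθ' : θ ∈ Icc (0 : ℝ) 1 := ⟨by positivity, (div_le_one h0).2 (by linarith)⟩
  have ex : θ • y + (1 - θ) • pt q = upperPt ε q := by
    refine Prod.ext ?_ ?_
    · simp [pt, upperPt]; linarith
    · simp only [Prod.snd_add, Prod.smul_snd, smul_eq_mul, hy, pt, upperPt]
      linear_combination -(2 * q - 2 * ε) * e
  refine ⟨join θ φ fun _ => q, (hφ.join (Piece.const f ε q) (s := q - 2 * ε) (t := q) hθ'
    (by apply le_of_eq; ring) hs (prefixBelow_const (by simp)) ?_).congr ex ?_, ?_⟩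
  · simp [pt]; linarith
  · rw [← ex, β.eval_combo, hfq]
  · exact hs.join hφ.toMoments (Moments.const f q) hθ' (suffixBelow_const (by simp))
      (by simp [chordIntegral_const])

/-- An optimizer on a right tangent segment. -/
lemma Ready.exists_piece (hε : 0 < ε) (h : Ready f ε p V) (h1 : p - ε ≤ x.1) (h2 : x.1 ≤ p)
    (hx : x.2 = (2 * p - 2 * ε) * x.1 - p * (p - 2 * ε)) {m : ℝ} (hV : V = f p - ε * m) :
    ∃ φ, Piece f ε φ x (m * (x.1 - p) + f p) := by
  obtain ⟨ψ, hψ, hs⟩ := h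
  set θ := (p - x.1) / ε with hθ
  have e : θ * ε = p - x.1 := by rw [hθ]; field_simp
  have hθ' : θ ∈ Icc (0 : ℝ) 1 := ⟨div_nonneg (by linarith) hε.le,
    (div_le_one hε).2 (by linarith)⟩
  refine ⟨join θ ψ fun _ => p, (hψ.join (Piece.const f ε p) (s := p - 2 * ε) (t := p) hθ'
    (by apply le_of_eq; ring) hs (prefixBelow_const (by simp)) ?_).congr ?_ ?_⟩
  · simp [pt, upperPt, hε.le]
  · refine Prod.ext ?_ ?_
    · simp [pt, upperPt]; linarith
    · simp only [Prod.snd_add, Prod.smul_snd, smul_eq_mul, hx, pt, upperPt]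
      linear_combination -(2 * p - 2 * ε) * e
  · rw [hV]; linear_combination -m * e

/-- An optimizer on a chord. -/
lemma exists_piece_chord (f : ℝ → ℝ) {a b : ℝ} (hab : a ≤ b) (h : b - a ≤ 2 * ε)
    {c : ℝ} (hc : c ∈ Icc (0 : ℝ) 1) :
    ∃ φ, Piece f ε φ ((1 - c) • pt a + c • pt b) ((1 - c) * f a + c * f b) := by
  have := (Piece.const f ε a).join (Piece.const f ε b) (s := a) (t := b) (one_sub_mem hc)
    (pow_le_pow_left₀ (by linarith) h 2) (suffixBelow_const (by simp))
    (prefixBelow_const (by simp)) hab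
  rw [sub_sub_cancel] at this
  exact ⟨_, this⟩

end parts

/-! ### Growth of the boundary function -/

/-- Exponential growth of rate less than `1 / ε`. -/
def SubExp (ε : ℝ) (g : ℝ → ℝ) : Prop :=
  ∃ C k : ℝ, 0 ≤ k ∧ k * ε < 1 ∧ ∀ v, |g v| ≤ C * Real.exp (k * |v|)

section growth

variable {f g M : ℝ → ℝ} {ε u V : ℝ}

lemma SubExp.of_deriv (hε : 0 < ε) (hg : Differentiable ℝ g) (h : SubExp ε (deriv g)) :
    SubExp ε g := by
  obtain ⟨C, k, hk, hkε, hC⟩ := h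
  have hC0 : 0 ≤ C := by simpa using (abs_nonneg _).trans (hC 0)
  -- Half of the spare rate 1/ε - k absorbs the linear factor |v| produced by the mean value
  -- inequality.
  set κ := (1 / ε - k) / 2 with hκ
  have h1 : k < 1 / ε := (lt_div_iff₀ hε).2 hkε
  have hκ0 : 0 < κ := by rw [hκ]; linarith
  refine ⟨|g 0| + C / κ, k + κ, by positivity, ?_, fun v => ?_⟩
  · rw [← lt_div_iff₀ hε]; linarith
  have hmvt : |g v - g 0| ≤ C * Real.exp (k * |v|) * |v - 0| := by
    have := (convex_Icc (-|v|) |v|).norm_image_sub_le_of_norm_deriv_le (f := g)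
      (C := C * Real.exp (k * |v|)) (x := 0) (y := v) (fun w _ => hg w) (fun w hw => ?_)
      (by simp) ⟨neg_abs_le v, le_abs_self v⟩
    · simpa [Real.norm_eq_abs] using this
    · rw [Real.norm_eq_abs]
      refine (hC w).trans ?_
      have : |w| ≤ |v| := abs_le.2 hw
      gcongr
  rw [sub_zero] at hmvt
  have h2 : |v| ≤ Real.exp (κ * |v|) / κ := by
    rw [le_div_iff₀ hκ0, mul_comm]
    linarith [Real.add_one_le_exp (κ * |v|)]
  have h3 : 1 ≤ Real.exp ((k + κ) * |v|) := Real.one_le_exp (by positivity)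
  have h4 : C * Real.exp (k * |v|) * |v| ≤ C / κ * Real.exp ((k + κ) * |v|) := by
    calc C * Real.exp (k * |v|) * |v|
        ≤ C * Real.exp (k * |v|) * (Real.exp (κ * |v|) / κ) := by gcongr
      _ = C / κ * Real.exp ((k + κ) * |v|) := by rw [add_mul, Real.exp_add]; ring
  have h5 : |g v| ≤ |g 0| + |g v - g 0| := by
    have := abs_add_le (g 0) (g v - g 0); simpa using this
  have h6 : |g 0| ≤ |g 0| * Real.exp ((k + κ) * |v|) := le_mul_of_one_le_right (abs_nonneg _) h3
  linarith

lemma subExp_const (c : ℝ) : SubExp ε (fun _ => c) :=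
  ⟨|c|, 0, le_rfl, by simp, fun v => by simp⟩

lemma subExp_id (hε : 0 < ε) : SubExp ε (fun v => v) :=
  SubExp.of_deriv hε differentiable_id (by simpa using subExp_const 1)

lemma SubExp.const_mul (c : ℝ) (h : SubExp ε g) : SubExp ε (fun v => c * g v) := by
  obtain ⟨C, k, hk, hkε, hC⟩ := h
  refine ⟨|c| * C, k, hk, hkε, fun v => ?_⟩
  rw [abs_mul, mul_assoc]
  exact mul_le_mul_of_nonneg_left (hC v) (abs_nonneg c)

lemma subExp_sq (hε : 0 < ε) : SubExp ε (fun v => v ^ 2) := by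
  refine SubExp.of_deriv hε (by fun_prop) ?_
  have : deriv (fun v : ℝ => v ^ 2) = fun v => 2 * v := by ext v; simp
  rw [this]
  exact (subExp_id hε).const_mul 2

/-- The increment of f'' between 0 and v is at most the variation there, where the weight is at
least exp(-|v|/ε∞); Chebyshev's inequality bounds it by a multiple of exp(|v|/ε∞), and 1/ε∞ < 1/ε.
-/
lemma subExp_deriv_deriv {epsInf : ℝ} (hε : 0 < ε) (hlt : ε < epsInf)
    (h : SummabilityCondition f epsInf) : SubExp ε (deriv (deriv f)) := by
  obtain ⟨μ, hμ, hfin⟩ := h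
  have hE : 0 < epsInf := hε.trans hlt
  set I := ∫⁻ t, ENNReal.ofReal (Real.exp (-|t| / epsInf)) ∂μ with hI
  set F := deriv (deriv f)
  refine ⟨|F 0| + I.toReal, 1 / epsInf, by positivity, ?_, fun v => ?_⟩
  · rw [one_div_mul_eq_div, div_lt_one hE]; exact hlt
  have key : |F v - F 0| ≤ I.toReal * Real.exp (1 / epsInf * |v|) := by
    have h1 : edist (F v) (F 0) ≤ μ (Icc (min v 0) (max v 0)) := by
      rw [hμ _ _ min_le_max]
      exact eVariationOn.edist_le _ ⟨min_le_left _ _, le_max_left _ _⟩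
        ⟨min_le_right _ _, le_max_right _ _⟩
    have h2 : ENNReal.ofReal (Real.exp (-|v| / epsInf)) * μ (Icc (min v 0) (max v 0)) ≤ I := by
      refine le_trans ?_ (mul_meas_ge_le_lintegral₀ (by fun_prop)
        (ENNReal.ofReal (Real.exp (-|v| / epsInf))))
      gcongr
      intro t ht
      refine ENNReal.ofReal_le_ofReal (Real.exp_le_exp.2 ?_)
      have : |t| ≤ |v| := by
        rcases le_total v 0 with h | h
        · rw [min_eq_left h, max_eq_right h] at ht
          rw [abs_of_nonpos h, abs_of_nonpos ht.2]; linarith [ht.1]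
        · rw [min_eq_right h, max_eq_left h] at ht
          rw [abs_of_nonneg h, abs_of_nonneg ht.1]; exact ht.2
      gcongr
    have h3 := (mul_le_mul_right h1 (ENNReal.ofReal (Real.exp (-|v| / epsInf)))).trans h2
    rw [edist_dist, ← ENNReal.ofReal_mul (Real.exp_pos _).le,
      ENNReal.ofReal_le_iff_le_toReal hfin.ne, Real.dist_eq] at h3
    have h4 : Real.exp (1 / epsInf * |v|) * Real.exp (-|v| / epsInf) = 1 := by
      rw [← Real.exp_add, Real.exp_eq_one_iff]; ring
    calc |F v - F 0| = Real.exp (1 / epsInf * |v|) * (Real.exp (-|v| / epsInf) * |F v - F 0|) := by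
          rw [← mul_assoc, h4, one_mul]
      _ ≤ Real.exp (1 / epsInf * |v|) * I.toReal := by gcongr
      _ = _ := mul_comm _ _
  have h5 : |F v| ≤ |F 0| + |F v - F 0| := by
    have := abs_add_le (F 0) (F v - F 0); simpa using this
  have h6 : |F 0| ≤ |F 0| * Real.exp (1 / epsInf * |v|) :=
    le_mul_of_one_le_right (abs_nonneg _) (Real.one_le_exp (by positivity))
  linarith

lemma SubExp.neg (h : SubExp ε g) : SubExp ε (fun v => g (-v)) := by
  obtain ⟨C, k, hk, hkε, hC⟩ := h
  exact ⟨C, k, hk, hkε, fun v => by simpa using hC (-v)⟩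

/-- Exponential growth at rate k becomes the power t^(-kε), which is integrable at 0 and is killed
by a factor t because kε < 1. -/
lemma exp_abs_log_le (hε : 0 < ε) {k : ℝ} (hk : 0 ≤ k) (u : ℝ) {t : ℝ} (ht : t ∈ Ioc (0 : ℝ) 1) :
    Real.exp (k * |u + ε * Real.log t|) ≤ Real.exp (k * |u|) * t ^ (-(k * ε)) := by
  rw [Real.rpow_def_of_pos ht.1, ← Real.exp_add]
  refine Real.exp_le_exp.2 ?_
  have h1 : |u + ε * Real.log t| ≤ |u| + |ε * Real.log t| := abs_add_le _ _
  have h2 : |ε * Real.log t| = -(ε * Real.log t) :=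
    abs_of_nonpos (mul_nonpos_of_nonneg_of_nonpos hε.le (Real.log_nonpos ht.1.le ht.2))
  rw [h2] at h1
  nlinarith [mul_le_mul_of_nonneg_left h1 hk]

lemma SubExp.intervalIntegrable_log (hε : 0 < ε) (hg : Continuous g) (h : SubExp ε g) (u : ℝ) :
    IntervalIntegrable (fun t => g (u + ε * Real.log t)) volume 0 1 := by
  obtain ⟨C, k, hk, hkε, hC⟩ := h
  have hC0 : 0 ≤ C := by simpa using (abs_nonneg _).trans (hC 0)
  have h1 : IntervalIntegrable (fun t : ℝ => C * Real.exp (k * |u|) * t ^ (-(k * ε))) volume 0 1 :=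
    (intervalIntegral.intervalIntegrable_rpow' (by linarith)).const_mul _
  refine h1.mono_fun ?_ ?_
  · exact (hg.measurable.comp (by fun_prop)).aestronglyMeasurable
  · refine (ae_restrict_iff' measurableSet_uIoc).2 (Filter.Eventually.of_forall fun t ht => ?_)
    rw [uIoc_of_le zero_le_one] at ht
    have h0 := Real.rpow_nonneg ht.1.le (-(k * ε))
    beta_reduce
    rw [Real.norm_eq_abs, Real.norm_of_nonneg (by positivity), mul_assoc]
    exact (hC _).trans (mul_le_mul_of_nonneg_left (exp_abs_log_le hε hk u ht) hC0)

/-- Only the behaviour near -∞ matters, so the bound is required below some `v₀`: the slope of a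
tangent domain is controlled only there. -/
lemma tendsto_mul_log (hε : 0 < ε) {C k v₀ : ℝ} (hk : 0 ≤ k) (hkε : k * ε < 1)
    (hC : ∀ v ≤ v₀, |g v| ≤ C * Real.exp (k * |v|)) (u : ℝ) :
    Filter.Tendsto (fun t => t * g (u + ε * Real.log t)) (nhdsWithin 0 (Ioi 0)) (nhds 0) := by
  have hC0 : 0 ≤ C := nonneg_of_mul_nonneg_left ((abs_nonneg _).trans (hC v₀ le_rfl))
    (Real.exp_pos _)
  have h1 : Filter.Tendsto (fun t : ℝ => C * Real.exp (k * |u|) * t ^ (1 - k * ε))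
      (nhdsWithin 0 (Ioi 0)) (nhds 0) := by
    have : Filter.Tendsto (fun t : ℝ => t ^ (1 - k * ε)) (nhds 0) (nhds 0) := by
      have := (Real.continuousAt_rpow_const 0 (1 - k * ε) (Or.inr (by linarith))).tendsto
      rwa [Real.zero_rpow (by linarith)] at this
    simpa using (this.mono_left nhdsWithin_le_nhds).const_mul (C * Real.exp (k * |u|))
  refine squeeze_zero_norm' ?_ h1
  have h2 : Filter.Tendsto (fun t => u + ε * Real.log t) (nhdsWithin 0 (Ioi 0)) Filter.atBot :=
    Filter.tendsto_atBot_add_const_left _ _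
      (Real.tendsto_log_nhdsGT_zero.const_mul_atBot hε)
  filter_upwards [h2.eventually_le_atBot v₀, Ioc_mem_nhdsGT (zero_lt_one' ℝ)] with t hv ht
  rw [norm_mul, Real.norm_of_nonneg ht.1.le, Real.norm_eq_abs]
  calc t * |g (u + ε * Real.log t)|
      ≤ t * (C * (Real.exp (k * |u|) * t ^ (-(k * ε)))) := by
        have := (hC _ hv).trans (mul_le_mul_of_nonneg_left (exp_abs_log_le hε hk u ht) hC0)
        exact mul_le_mul_of_nonneg_left this ht.1.le
    _ = C * Real.exp (k * |u|) * (t ^ (1 : ℝ) * t ^ (-(k * ε))) := by rw [Real.rpow_one]; ring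
    _ = _ := by rw [← Real.rpow_add ht.1, ← sub_eq_add_neg]

lemma SubExp.tendsto_mul_log (hε : 0 < ε) (h : SubExp ε g) (u : ℝ) :
    Filter.Tendsto (fun t => t * g (u + ε * Real.log t)) (nhdsWithin 0 (Ioi 0)) (nhds 0) := by
  obtain ⟨C, k, hk, hkε, hC⟩ := h
  exact BMOBellman.tendsto_mul_log hε hk hkε (v₀ := 0) (fun v _ => hC v) u

/-- The integral formula passes the growth rate k from g to M for negative arguments, with the
constant divided by ε(1/ε - k). -/
lemma tendsto_mul_slope (hε : 0 < ε) (hg : SubExp ε g)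
    (hM : ∀ v ≤ u, M v = ε⁻¹ * Real.exp (-v / ε) * ∫ t in Iic v, g t * Real.exp (t / ε)) :
    Filter.Tendsto (fun t => t * M (u + ε * Real.log t)) (nhdsWithin 0 (Ioi 0)) (nhds 0) := by
  obtain ⟨C, k, hk, hkε, hC⟩ := hg
  have hr : 0 < 1 / ε - k := sub_pos.2 ((lt_div_iff₀ hε).2 hkε)
  refine BMOBellman.tendsto_mul_log (C := ε⁻¹ * (C / (1 / ε - k))) hε hk hkε (v₀ := min u 0)
    (fun v hv => ?_) u
  have hv0 : v ≤ 0 := hv.trans (min_le_right _ _)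
  rw [hM v (hv.trans (min_le_left _ _)), abs_mul,
    abs_of_pos (by positivity : 0 < ε⁻¹ * Real.exp (-v / ε))]
  have h1 : |∫ t in Iic v, g t * Real.exp (t / ε)| ≤
      ∫ t in Iic v, C * Real.exp ((1 / ε - k) * t) := by
    rw [← Real.norm_eq_abs]
    refine norm_integral_le_of_norm_le ((integrableOn_exp_mul_Iic hr v).const_mul C) ?_
    refine (ae_restrict_iff' measurableSet_Iic).2 (Filter.Eventually.of_forall fun t ht => ?_)
    rw [norm_mul, Real.norm_eq_abs, Real.norm_of_nonneg (Real.exp_pos _).le]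
    refine (mul_le_mul_of_nonneg_right (hC t) (Real.exp_pos _).le).trans_eq ?_
    rw [abs_of_nonpos (le_trans ht hv0), mul_assoc, ← Real.exp_add]
    congr 2; ring
  rw [integral_const_mul, integral_exp_mul_Iic hr] at h1
  refine (mul_le_mul_of_nonneg_left h1 (by positivity)).trans_eq ?_
  rw [abs_of_nonpos hv0]
  have h2 : Real.exp (-v / ε) * Real.exp ((1 / ε - k) * v) = Real.exp (k * -v) := by
    rw [← Real.exp_add]; congr 1; ring
  rw [← h2]; ring

end growth

/-! ### Logarithms -/

section log

variable {f g M φ : ℝ → ℝ} {ε u V : ℝ}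

/-- Along v = u + ε log t one has t dv/dt = ε, so the derivative is g - εM + ε(g' - εM'), and the
equation εM' + M = g' leaves g. -/
lemma hasDerivAt_log_piece (hε : ε ≠ 0) {t : ℝ} (ht : 0 < t) (hg : Differentiable ℝ g)
    (hM : HasDerivAt M ((deriv g (u + ε * Real.log t) - M (u + ε * Real.log t)) / ε)
      (u + ε * Real.log t)) :
    HasDerivAt (fun t => t * (g (u + ε * Real.log t) - ε * M (u + ε * Real.log t)))
      (g (u + ε * Real.log t)) t := by
  have hv : HasDerivAt (fun t => u + ε * Real.log t) (ε * t⁻¹) t :=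
    ((Real.hasDerivAt_log ht.ne').const_mul ε).const_add u
  have h1 := (hg (u + ε * Real.log t)).hasDerivAt.comp t hv
  have h2 := (hM.comp t hv).const_mul ε
  refine ((hasDerivAt_id t).mul (h1.sub h2)).congr_deriv ?_
  simp only [id, Pi.sub_apply, Function.comp_apply]
  field_simp
  ring

lemma log_piece_mono (hε : 0 < ε) (u : ℝ) {a b : ℝ} (ha : 0 < a) (hab : a ≤ b) :
    u + ε * Real.log a ≤ u + ε * Real.log b := by
  have := Real.log_le_log ha hab
  gcongr

lemma log_piece_lt (hε : 0 < ε) (u : ℝ) {a b : ℝ} (ha : 0 < a) (hab : a < b) :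
    u + ε * Real.log a < u + ε * Real.log b := by
  have := Real.log_lt_log ha hab
  gcongr

lemma intervalIntegrable_log_piece (hg : Continuous g) (ε u : ℝ) {a b : ℝ} (ha : 0 < a)
    (hab : a ≤ b) : IntervalIntegrable (fun t => g (u + ε * Real.log t)) volume a b := by
  refine ContinuousOn.intervalIntegrable ?_
  rw [uIcc_of_le hab]
  refine hg.comp_continuousOn (continuousOn_const.add (continuousOn_const.mul ?_))
  exact Real.continuousOn_log.mono fun t ht => (ha.trans_le ht.1).ne'

lemma continuousOn_log_piece (hε : 0 < ε) {a b : ℝ} (ha : 0 < a) (hg : Continuous g)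
    (hMc : ContinuousOn M (Icc (u + ε * Real.log a) (u + ε * Real.log b))) :
    ContinuousOn (fun t => t * (g (u + ε * Real.log t) - ε * M (u + ε * Real.log t)))
      (Icc a b) := by
  have hl : ContinuousOn (fun t => u + ε * Real.log t) (Icc a b) :=
    continuousOn_const.add (continuousOn_const.mul
      (Real.continuousOn_log.mono fun t ht => (ha.trans_le ht.1).ne'))
  refine continuousOn_id.mul ((hg.comp_continuousOn hl).sub (continuousOn_const.mul
    (hMc.comp hl fun t ht => ⟨log_piece_mono hε u ha ht.1,
      log_piece_mono hε u (ha.trans_le ht.1) ht.2⟩)))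

lemma integral_log_piece (hε : 0 < ε) {a b : ℝ} (ha : 0 < a) (hab : a ≤ b)
    (hg : Differentiable ℝ g)
    (hMc : ContinuousOn M (Icc (u + ε * Real.log a) (u + ε * Real.log b)))
    (hM : ∀ v ∈ Ioo (u + ε * Real.log a) (u + ε * Real.log b),
      HasDerivAt M ((deriv g v - M v) / ε) v) :
    ∫ t in a..b, g (u + ε * Real.log t) =
      b * (g (u + ε * Real.log b) - ε * M (u + ε * Real.log b)) -
        a * (g (u + ε * Real.log a) - ε * M (u + ε * Real.log a)) := by
  refine intervalIntegral.integral_eq_sub_of_hasDerivAt_of_le hab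
    (continuousOn_log_piece hε ha hg.continuous hMc) (fun t ht => ?_)
    (intervalIntegrable_log_piece hg.continuous ε u ha hab)
  exact hasDerivAt_log_piece hε.ne' (ha.trans ht.1) hg (hM _
    ⟨log_piece_lt hε u ha ht.1, log_piece_lt hε u (ha.trans ht.1) ht.2⟩)

lemma integral_log_piece_zero (hε : 0 < ε) {b : ℝ} (hb : 0 < b) (hb1 : b ≤ 1)
    (hg : Differentiable ℝ g) (hexp : SubExp ε g)
    (hMc : ContinuousOn M (Iic u)) (hM : ∀ v < u, HasDerivAt M ((deriv g v - M v) / ε) v)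
    (hlim : Filter.Tendsto (fun t => t * M (u + ε * Real.log t))
      (nhdsWithin 0 (Ioi 0)) (nhds 0)) :
    ∫ t in (0 : ℝ)..b, g (u + ε * Real.log t) =
      b * (g (u + ε * Real.log b) - ε * M (u + ε * Real.log b)) := by
  have hle : ∀ t, 0 < t → t ≤ 1 → u + ε * Real.log t ≤ u := fun t h0 h1 => by
    simpa using log_piece_mono hε u h0 h1
  have h := intervalIntegral.integral_eq_sub_of_hasDerivAt_of_tendsto
    (f := fun t => t * (g (u + ε * Real.log t) - ε * M (u + ε * Real.log t)))
    (f' := fun t => g (u + ε * Real.log t)) (a := 0) (b := b) hb (fa := 0)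
    (fb := b * (g (u + ε * Real.log b) - ε * M (u + ε * Real.log b))) (fun t ht => ?_) ?_ ?_ ?_
  · rw [h, sub_zero]
  · refine hasDerivAt_log_piece hε.ne' ht.1 hg (hM _ ?_)
    exact (log_piece_lt hε u ht.1 ht.2).trans_le (hle b hb hb1)
  · refine (hexp.intervalIntegrable_log hε hg.continuous u).mono_set ?_
    rw [uIcc_of_le hb.le, uIcc_of_le zero_le_one]
    exact Icc_subset_Icc_right hb1
  · have h1 := (hexp.tendsto_mul_log hε u).sub (hlim.const_mul ε)
    simp only [mul_zero, sub_zero] at h1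
    exact h1.congr fun t => by ring
  · have h1 := continuousOn_log_piece (M := M) (u := u) hε (half_pos hb) hg.continuous (b := b)
      (hMc.mono fun v hv => hv.2.trans (hle b hb hb1))
    have h2 := (h1 b ⟨by linarith, le_rfl⟩).tendsto
    refine h2.mono_left ?_
    rw [← nhdsWithin_Ioo_eq_nhdsLT (half_lt_self hb)]
    exact nhdsWithin_mono _ Ioo_subset_Icc_self

/-- A function whose Bellman points over `[0, d]`, `d ≥ α`, run along the upper boundary. -/
lemma ready_of_log (hm : Moments f φ (upperPt ε u) V) (hε : 0 < ε) {α : ℝ} (hα1 : α ≤ 1)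
    (hbig : ∀ d, α ≤ d → 0 < d → d ≤ 1 →
      ∫ t in (0 : ℝ)..d, φ t = d * (u + ε * Real.log d - ε) ∧
      ∫ t in (0 : ℝ)..d, φ t ^ 2 = d * ((u + ε * Real.log d - ε) ^ 2 + ε ^ 2))
    (hsmall : ∀ c, 0 < c → c < α →
      0 ≤ chordIntegral φ (u + ε * Real.log α - 2 * ε) (u + ε * Real.log α) c ∧
      ∫ t in (0 : ℝ)..c, φ t ≤ c * (u + ε * Real.log α - ε))
    (hosc : ∀ c d : ℝ, 0 ≤ c → c < d → d < α →
      ∃ s t : ℝ, (t - s) ^ 2 ≤ (2 * ε) ^ 2 ∧ chordIntegral φ s t d ≤ chordIntegral φ s t c) :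
    Ready f ε u V := by
  -- The prefix over [0, d] sits at the tangency point with foot v = u + ε log d, so an interval [c,
  -- d] is below that tangent exactly when the prefix over [0, c] is above it.
  have key : ∀ c d, 0 ≤ c → c ≤ d → α ≤ d → 0 < d → d ≤ 1 →
      0 ≤ chordIntegral φ (u + ε * Real.log d - 2 * ε) (u + ε * Real.log d) c ∧
      ∫ t in (0 : ℝ)..c, φ t ≤ c * (u + ε * Real.log d - ε) := by
    intro c d hc hcd hαd hd hd1
    rcases hc.eq_or_lt with rfl | hc0
    · simp [chordIntegral]
    have hcI : c ∈ Icc (0 : ℝ) 1 := ⟨hc, hcd.trans hd1⟩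
    rcases le_or_gt α c with hαc | hαc
    · obtain ⟨h1, h2⟩ := hbig c hαc hc0 (hcd.trans hd1)
      rw [chordIntegral_eq hm.int1 hm.int2 _ _ hcI, h1, h2]
      refine ⟨?_, ?_⟩
      -- For c ≥ α the prefix point is itself on the upper boundary, a parabola above its tangents;
      -- the square is the vertical gap.
      · have := mul_nonneg hc (sq_nonneg (ε * Real.log c - ε * Real.log d))
        linarith
      · have := mul_le_mul_of_nonneg_left (log_piece_mono hε u hc0 hcd) hc
        linarith
    · obtain ⟨h1, h2⟩ := hsmall c hc0 hαc
      have h3 := log_piece_mono hε u (hc0.trans hαc) hαd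
      set p := u + ε * Real.log α
      set v := u + ε * Real.log d
      have h4 := mul_nonneg hc (sub_nonneg.2 h3)
      refine ⟨?_, by linarith⟩
      rw [chordIntegral_eq hm.int1 hm.int2 _ _ hcI] at h1 ⊢
      -- Passing from the tangent with foot `p` to the one with foot `v` ≥ `p` changes the integral
      -- by an affine function of the prefix mean, and the bound on the mean makes the change at
      -- least c(v - p)².
      have h5 := mul_le_mul_of_nonneg_left h2 (sub_nonneg.2 h3)
      have h6 := mul_nonneg hc (sq_nonneg (v - p))
      linarith
  have key' : ∀ c d, 0 ≤ c → c ≤ d → α ≤ d → 0 < d → d ≤ 1 →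
      chordIntegral φ (u + ε * Real.log d - 2 * ε) (u + ε * Real.log d) d ≤
        chordIntegral φ (u + ε * Real.log d - 2 * ε) (u + ε * Real.log d) c := by
    intro c d hc hcd hαd hd hd1
    refine le_trans (le_of_eq ?_) (key c d hc hcd hαd hd hd1).1
    obtain ⟨h1, h2⟩ := hbig d hαd hd hd1
    rw [chordIntegral_eq hm.int1 hm.int2 _ _ ⟨hd.le, hd1⟩, h1, h2]
    ring
  refine ⟨φ, ⟨hm, fun c d hc hcd hd => ?_, fun c hc => ?_⟩, fun c hc => ?_⟩
  · rcases lt_or_ge d α with h | h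
    · exact hosc c d hc hcd h
    · exact ⟨_, _, by apply le_of_eq; ring, key' c d hc hcd.le h (hc.trans_lt hcd) hd⟩
  · simpa [upperPt] using (key c 1 hc.1 hc.2 hα1 one_pos le_rfl).2
  · simpa using key' c 1 hc.1 hc.2 hα1 one_pos le_rfl

/-- The functions v and v² have slopes 1 and 2v - 2ε solving the same equation εM' + M = g'. Hence
the two coordinates of the Bellman point and the average of f come from one computation. -/
lemma hasDerivAt_slope_id (ε v : ℝ) : HasDerivAt (fun _ : ℝ => (1 : ℝ))
    ((deriv (fun v : ℝ => v) v - 1) / ε) v := by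
  simpa using hasDerivAt_const v (1 : ℝ)

lemma hasDerivAt_slope_sq (hε : 0 < ε) (v : ℝ) : HasDerivAt (fun v : ℝ => 2 * v - 2 * ε)
    ((deriv (fun v : ℝ => v ^ 2) v - (2 * v - 2 * ε)) / ε) v := by
  refine (((hasDerivAt_id v).const_mul 2).sub_const (2 * ε)).congr_deriv ?_
  simp
  field_simp

/-- The logarithm is an optimizer on the tangent domains that come from infinity. -/
lemma ready_of_tangents_from_bot (hε : 0 < ε) (hf : Differentiable ℝ f)
    (hexp : SubExp ε f) (hexp' : SubExp ε (deriv f)) (hMc : ContinuousOn M (Iic u))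
    (hM : ∀ v < u, HasDerivAt M ((deriv f v - M v) / ε) v)
    (hMeq : ∀ v ≤ u, M v = ε⁻¹ * Real.exp (-v / ε) *
      ∫ t in Iic v, deriv f t * Real.exp (t / ε)) :
    Ready f ε u (f u - ε * M u) := by
  have e1 : ∀ b, 0 < b → b ≤ 1 → ∫ t in (0 : ℝ)..b, (u + ε * Real.log t) =
      b * (u + ε * Real.log b - ε) := fun b hb hb1 => by
    have := integral_log_piece_zero (u := u) (M := fun _ => 1) hε hb hb1 differentiable_id
      (subExp_id hε) continuousOn_const (fun v _ => hasDerivAt_slope_id ε v)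
      ((subExp_const 1).tendsto_mul_log hε u)
    simpa using this
  have e2 : ∀ b, 0 < b → b ≤ 1 → ∫ t in (0 : ℝ)..b, (u + ε * Real.log t) ^ 2 =
      b * ((u + ε * Real.log b - ε) ^ 2 + ε ^ 2) := fun b hb hb1 => by
    have hlim := (((subExp_id hε).const_mul 2).tendsto_mul_log hε u).sub
      ((subExp_const (2 * ε)).tendsto_mul_log hε u)
    have := integral_log_piece_zero (u := u) (g := fun v => v ^ 2) (M := fun v => 2 * v - 2 * ε)
      hε hb hb1 (by fun_prop) (subExp_sq hε) (by fun_prop) (fun v _ => hasDerivAt_slope_sq hε v)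
      (by simpa [mul_sub] using hlim)
    rw [this]; ring
  have e3 := integral_log_piece_zero hε one_pos le_rfl hf hexp hMc hM
    (tendsto_mul_slope hε hexp' hMeq)
  -- With α = 0 there is no initial function and the conditions on times below α are vacuous.
  refine ready_of_log (φ := fun t => u + ε * Real.log t) (α := 0) ⟨?_, ?_, ?_, ?_, ?_, ?_⟩ hε
    zero_le_one (fun d _ h0 h1 => ⟨e1 d h0 h1, e2 d h0 h1⟩) (fun c h0 h1 => absurd h1 h0.not_gt)
    (fun c d h0 h1 h2 => absurd h2 (h0.trans h1.le).not_gt)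
  · exact (subExp_id hε).intervalIntegrable_log hε continuous_id u
  · exact (subExp_sq hε).intervalIntegrable_log hε (by fun_prop) u
  · exact hexp.intervalIntegrable_log hε hf.continuous u
  · simpa [upperPt] using e1 1 one_pos le_rfl
  · simpa [upperPt] using e2 1 one_pos le_rfl
  · simpa using e3

/-- Optimizers are carried along a domain of right tangents. -/
lemma Ready.of_tangents (hε : 0 < ε) (hf : Differentiable ℝ f) {u₁ u₂ : ℝ} (hu : u₁ ≤ u₂)
    (hMc : ContinuousOn M (Icc u₁ u₂))
    (hM : ∀ v ∈ Ioo u₁ u₂, HasDerivAt M ((deriv f v - M v) / ε) v)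
    (h : Ready f ε u₁ (f u₁ - ε * M u₁)) : Ready f ε u₂ (f u₂ - ε * M u₂) := by
  obtain ⟨ψ, hψ, hs⟩ := h
  -- Chosen so that u₂ + ε log α = u₁: the logarithm starts at the foot where ψ ends.
  set α := Real.exp (-(u₂ - u₁) / ε) with hα
  have hα0 : 0 < α := Real.exp_pos _
  have hα1 : α ≤ 1 := Real.exp_le_one_iff.2 (div_nonpos_of_nonpos_of_nonneg (by linarith) hε.le)
  have hαI : α ∈ Icc (0 : ℝ) 1 := ⟨hα0.le, hα1⟩
  have hlog : u₂ + ε * Real.log α = u₁ := by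
    rw [hα, Real.log_exp]; field_simp; ring
  -- The affine substitution undoes the rescaling in `join`, so the concatenation is u₂ + ε log t on
  -- (α, 1].
  set η : ℝ → ℝ := fun t => u₂ + ε * Real.log (α + (1 - α) * t) with hη
  have hint : ∀ g : ℝ → ℝ, Continuous g → IntervalIntegrable (fun t => g (η t)) volume 0 1 := by
    intro g hg
    refine ContinuousOn.intervalIntegrable ?_
    rw [uIcc_of_le zero_le_one]
    refine hg.comp_continuousOn (continuousOn_const.add (continuousOn_const.mul
      (ContinuousOn.log (by fun_prop) fun t ht => ?_)))
    have : 0 ≤ (1 - α) * t := mul_nonneg (sub_nonneg.2 hα1) ht.1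
    linarith
  have hpre : ∀ (g N : ℝ → ℝ), Differentiable ℝ g →
      IntervalIntegrable (fun t => g (ψ t)) volume 0 1 →
      ∫ t in (0 : ℝ)..1, g (ψ t) = g u₁ - ε * N u₁ → ContinuousOn N (Icc u₁ u₂) →
      (∀ v ∈ Ioo u₁ u₂, HasDerivAt N ((deriv g v - N v) / ε) v) →
      ∀ d, α ≤ d → d ≤ 1 → ∫ t in (0 : ℝ)..d, g (join α ψ η t) =
        d * (g (u₂ + ε * Real.log d) - ε * N (u₂ + ε * Real.log d)) := by
    intro g N hg hgi hge hNc hN d hαd hd1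
    obtain ⟨d', hd', rfl⟩ : ∃ c' ∈ Icc (0 : ℝ) 1, d = α + (1 - α) * c' := by
      rcases mem_left_or_mem_right hαI ⟨hα0.le.trans hαd, hd1⟩ with ⟨h, -⟩ | ⟨-, h⟩
      · exact ⟨0, by simp, by linarith⟩
      · exact h
    rw [integral_join_right hαI hgi (hint g hg.continuous) hd', hge]
    have hsub := intervalIntegral.mul_integral_comp_add_mul (a := 0) (b := d')
      (f := fun t => g (u₂ + ε * Real.log t)) (c := 1 - α) (d := α)
    rw [mul_zero, add_zero] at hsub
    have hle : u₂ + ε * Real.log (α + (1 - α) * d') ≤ u₂ := by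
      simpa using log_piece_mono hε u₂ (hα0.trans_le hαd) hd1
    rw [hη, hsub, integral_log_piece hε hα0 hαd hg
      (by rw [hlog]; exact hNc.mono (Icc_subset_Icc_right hle))
      (by rw [hlog]; exact fun v hv => hN v ⟨hv.1, hv.2.trans_le hle⟩), hlog]
    ring
  have hm1 : ∀ d, α ≤ d → d ≤ 1 → ∫ t in (0 : ℝ)..d, join α ψ η t =
      d * (u₂ + ε * Real.log d - ε) := fun d h0 h1 => by
    have := hpre (fun v => v) (fun _ => 1) differentiable_id hψ.int1
      (by simpa [upperPt] using hψ.avg1) continuousOn_const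
      (fun v _ => hasDerivAt_slope_id ε v) d h0 h1
    simpa using this
  have hm2 : ∀ d, α ≤ d → d ≤ 1 → ∫ t in (0 : ℝ)..d, join α ψ η t ^ 2 =
      d * ((u₂ + ε * Real.log d - ε) ^ 2 + ε ^ 2) := fun d h0 h1 => by
    have := hpre (fun v => v ^ 2) (fun v => 2 * v - 2 * ε) (by fun_prop) hψ.int2
      (by rw [hψ.avg2, upperPt]; ring) (by fun_prop)
      (fun v _ => hasDerivAt_slope_sq hε v) d h0 h1
    rw [this]; ring
  have hm3 := hpre f M hf hψ.intf hψ.avgf hMc hM 1 hα1 le_rfl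
  refine ready_of_log (φ := join α ψ η) (α := α) ⟨?_, ?_, ?_, ?_, ?_, ?_⟩ hε hα1
    (fun d h _ h1 => ⟨hm1 d h h1, hm2 d h h1⟩) (fun c h0 h1 => ?_) (fun c d h0 h1 h2 => ?_)
  · exact intervalIntegrable_join (g := fun v => v) hαI hψ.int1 (hint _ continuous_id)
  · exact intervalIntegrable_join (g := fun v => v ^ 2) hαI hψ.int2 (hint (fun v => v ^ 2) (by fun_prop))
  · exact intervalIntegrable_join hαI hψ.intf (hint _ hf.continuous)
  · simpa [upperPt] using hm1 1 hα1 le_rfl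
  · simpa [upperPt] using hm2 1 hα1 le_rfl
  · simpa using hm3
  · rw [hlog]
    obtain ⟨c', hc', rfl⟩ : ∃ c' ∈ Icc (0 : ℝ) 1, c = α * c' := by
      rcases mem_left_or_mem_right hαI ⟨h0.le, h1.le.trans hα1⟩ with ⟨-, h⟩ | ⟨h, -⟩
      · exact h
      · exact absurd h1 h.not_gt
    rw [chordIntegral_join_left _ _ _ _ hαI hc']
    refine ⟨mul_nonneg hα0.le (ready_prefix hψ hs hc'), ?_⟩
    rw [integral_join_left (fun v => v) hαI hc', mul_assoc]
    exact mul_le_mul_of_nonneg_left (hψ.mean c' hc') hα0.le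
  · have hc1 : c / α < d / α := by gcongr
    obtain ⟨s, t, hst, hle⟩ := hψ.osc (c / α) (d / α) (div_nonneg h0 hα0.le) hc1
      ((div_le_one hα0).2 h2.le)
    refine ⟨s, t, hst, ?_⟩
    have hd : d / α ∈ Icc (0 : ℝ) 1 := ⟨div_nonneg (h0.trans h1.le) hα0.le,
      (div_le_one hα0).2 h2.le⟩
    have hc : c / α ∈ Icc (0 : ℝ) 1 := ⟨div_nonneg h0 hα0.le, hc1.le.trans hd.2⟩
    have ec : α * (c / α) = c := by field_simp
    have ed : α * (d / α) = d := by field_simp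
    rw [← ec, ← ed, chordIntegral_join_left _ _ _ _ hαI hc, chordIntegral_join_left _ _ _ _ hαI hd]
    exact mul_le_mul_of_nonneg_left hle hα0.le

end log

/-! ### Chords and tangents -/

section geometry

variable {ε p q s t : ℝ} {x : ℝ × ℝ}

lemma foot_R (ε : ℝ) (x : ℝ × ℝ) :
    foot Dir.R ε x = x.1 + (ε - √(x.1 ^ 2 + ε ^ 2 - x.2)) := by simp [foot, Dir.sgn]

lemma foot_L (ε : ℝ) (x : ℝ × ℝ) :
    foot Dir.L ε x = x.1 - (ε - √(x.1 ^ 2 + ε ^ 2 - x.2)) := by simp [foot, Dir.sgn]; ring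

lemma strip_sqrt_le (hε : 0 < ε) (hx : x ∈ strip ε) : √(x.1 ^ 2 + ε ^ 2 - x.2) ≤ ε :=
  Real.sqrt_le_iff.2 ⟨hε.le, by linarith [hx.1]⟩

lemma foot_R_le_of_chord (hxt : x.1 ≤ t)
    (hst : t - s ≤ 2 * ε) (h : x.2 = (s + t) * x.1 - s * t) : foot Dir.R ε x ≤ t := by
  rw [foot_R]
  have : x.1 + ε - t ≤ √(x.1 ^ 2 + ε ^ 2 - x.2) := by
    refine Real.le_sqrt_of_sq_le ?_
    rw [h]
    nlinarith [mul_nonneg (sub_nonneg.2 hxt) (sub_nonneg.2 hst)]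
  linarith

lemma le_foot_L_of_chord (hsx : s ≤ x.1)
    (hst : t - s ≤ 2 * ε) (h : x.2 = (s + t) * x.1 - s * t) : s ≤ foot Dir.L ε x := by
  rw [foot_L]
  have : s + ε - x.1 ≤ √(x.1 ^ 2 + ε ^ 2 - x.2) := by
    refine Real.le_sqrt_of_sq_le ?_
    rw [h]
    nlinarith [mul_nonneg (sub_nonneg.2 hsx) (sub_nonneg.2 hst)]
  linarith

lemma foot_le_of_chord (hε : 0 < ε) (hx : x ∈ strip ε) (hxt : x.1 ≤ t)
    (hst : t - s ≤ 2 * ε) (h : x.2 = (s + t) * x.1 - s * t) (d : Dir) : foot d ε x ≤ t := by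
  cases d
  · exact foot_R_le_of_chord hxt hst h
  · rw [foot_L]; linarith [strip_sqrt_le hε hx]

lemma le_foot_of_chord (hε : 0 < ε) (hx : x ∈ strip ε) (hsx : s ≤ x.1)
    (hst : t - s ≤ 2 * ε) (h : x.2 = (s + t) * x.1 - s * t) (d : Dir) : s ≤ foot d ε x := by
  cases d
  · rw [foot_R]; linarith [strip_sqrt_le hε hx]
  · exact le_foot_L_of_chord hsx hst h

/-- The second inequality says that x is not below the line of the tangent with foot p. -/
lemma right_of_tangent (hx : x ∈ strip ε) (h : p ≤ foot Dir.R ε x) :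
    p - ε ≤ x.1 ∧ x.1 ^ 2 - x.2 ≤ (x.1 - p) * (x.1 - p + 2 * ε) := by
  rw [foot_R] at h
  have h0 := Real.sqrt_nonneg (x.1 ^ 2 + ε ^ 2 - x.2)
  have h1 := Real.sq_sqrt (show 0 ≤ x.1 ^ 2 + ε ^ 2 - x.2 by linarith [hx.2])
  exact ⟨by linarith, by nlinarith⟩

lemma left_of_tangent (hx : x ∈ strip ε) (h : foot Dir.L ε x ≤ q) :
    x.1 ≤ q + ε ∧ x.1 ^ 2 - x.2 ≤ (x.1 - q) * (x.1 - q - 2 * ε) := by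
  rw [foot_L] at h
  have h0 := Real.sqrt_nonneg (x.1 ^ 2 + ε ^ 2 - x.2)
  have h1 := Real.sq_sqrt (show 0 ≤ x.1 ^ 2 + ε ^ 2 - x.2 by linarith [hx.2])
  exact ⟨by linarith, by nlinarith⟩

/-- Used when the chord through x with midpoint abscissa x₁ starts left of p. The chord is turned
about x until it starts at `pt p`; its length stays at most 2ε because x is not to the left of the
left tangent at p. -/
lemma exists_chord_from_left (hx : x ∈ strip ε) (hp : p ≤ foot Dir.L ε x)
    (hε : 0 < ε) (hlt : x.1 - √(x.2 - x.1 ^ 2) < p) :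
    ∃ t, p ≤ x.1 ∧ x.1 ≤ t ∧ t - p ≤ 2 * ε ∧ x.2 = (p + t) * x.1 - p * t := by
  have hS := strip_sqrt_le hε hx
  rw [foot_L] at hp
  set S := √(x.1 ^ 2 + ε ^ 2 - x.2) with hSdef
  set δ := √(x.2 - x.1 ^ 2) with hδdef
  have h0 : 0 ≤ S := Real.sqrt_nonneg _
  have h1 : S ^ 2 = x.1 ^ 2 + ε ^ 2 - x.2 := Real.sq_sqrt (by linarith [hx.2])
  have h2 : 0 ≤ δ := Real.sqrt_nonneg _
  have h3 : δ ^ 2 = x.2 - x.1 ^ 2 := Real.sq_sqrt (by linarith [hx.1])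
  have hδε : δ ≤ ε := by nlinarith
  have hpx : p < x.1 := by
    rcases (show p ≤ x.1 by linarith).eq_or_lt with h | h
    · have h4 : S = ε := by linarith
      have h5 : δ = 0 := by nlinarith
      linarith
    · exact h
  have h4 : 0 < x.1 - p := sub_pos.2 hpx
  -- The second intersection with the parabola of the line through `pt p` and x.
  set τ := (x.2 - p * x.1) / (x.1 - p) with hτ
  have e : τ * (x.1 - p) = x.2 - p * x.1 := by rw [hτ]; field_simp
  refine ⟨τ, hpx.le, ?_, ?_, by linarith⟩
  · rw [hτ, le_div_iff₀ h4]; nlinarith [hx.1]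
  · have : τ ≤ p + 2 * ε := by
      rw [hτ, div_le_iff₀ h4]
      have h5 : 0 ≤ p + ε - x.1 := by linarith
      nlinarith
    linarith

lemma exists_chord_to_right (hx : x ∈ strip ε) (hq : foot Dir.R ε x ≤ q)
    (hε : 0 < ε) (hlt : q < x.1 + √(x.2 - x.1 ^ 2)) :
    ∃ s, s ≤ x.1 ∧ x.1 ≤ q ∧ q - s ≤ 2 * ε ∧ x.2 = (s + q) * x.1 - s * q := by
  obtain ⟨t, h1, h2, h3, h4⟩ := exists_chord_from_left (x := (-x.1, x.2)) (p := -q) (ε := ε)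
    (by simpa [strip] using hx) (by rw [foot_L]; rw [foot_R] at hq; simp; linarith) hε
    (by simp; linarith)
  simp only at h1 h2 h3 h4
  exact ⟨-t, by linarith, by linarith, by linarith, by linarith⟩

end geometry

/-! ### Linearity domains -/

lemma GapChain.le {p q : EReal} {gs : List (ℝ × ℝ)} (h : GapChain p gs q) : p ≤ q := by
  induction gs generalizing p with
  | nil => exact h
  | cons g gs ih =>
    exact h.1.trans ((EReal.coe_le_coe_iff.2 h.2.1.le).trans (ih h.2.2))

lemma GapChain.bounds {p q : EReal} {gs : List (ℝ × ℝ)} (h : GapChain p gs q) :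
    ∀ g ∈ gs, p ≤ (g.1 : EReal) ∧ g.1 < g.2 ∧ (g.2 : EReal) ≤ q := by
  induction gs generalizing p with
  | nil => simp
  | cons g gs ih =>
    intro k hk
    rcases List.mem_cons.1 hk with rfl | hk
    · exact ⟨h.1, h.2.1, h.2.2.le⟩
    · obtain ⟨h1, h2, h3⟩ := ih h.2.2 k hk
      exact ⟨(h.1.trans (EReal.coe_le_coe_iff.2 h.2.1.le)).trans h1, h2, h3⟩

lemma GapChain.ends_notMem {p q : EReal} {gs : List (ℝ × ℝ)} (h : GapChain p gs q) :
    ∀ g ∈ gs, ∀ k ∈ gs, g.1 ∉ Ioo k.1 k.2 ∧ g.2 ∉ Ioo k.1 k.2 := by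
  induction gs generalizing p with
  | nil => simp
  | cons g gs ih =>
    have hb : ∀ k ∈ gs, g.2 ≤ k.1 ∧ k.1 < k.2 := fun k hk =>
      ⟨EReal.coe_le_coe_iff.1 (h.2.2.bounds k hk).1, (h.2.2.bounds k hk).2.1⟩
    have hg := h.2.1
    intro k hk₀ j hj₀
    rcases List.mem_cons.1 hk₀ with rfl | hk <;> rcases List.mem_cons.1 hj₀ with rfl | hj
    · simp
    · have := hb j hj
      exact ⟨fun h' => by linarith [h'.1], fun h' => by linarith [h'.1]⟩
    · have := hb k hk
      exact ⟨fun h' => by linarith [h'.2], fun h' => by linarith [h'.2]⟩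
    · exact ih h.2.2 k hk j hj

section vertex

variable {f : ℝ → ℝ} {ε : ℝ} {β : Affine} {dl dr : Dir} {p q : EReal} {gaps : List (ℝ × ℝ)}
  {x : ℝ × ℝ} {s t : ℝ}

lemma VertexConditions.trace {v : Vertex} (h : VertexConditions f β v) :
    ∀ t ∈ v.arcs, f t = β.eval (pt t) := by
  intro t ht
  obtain ⟨h1, h2⟩ := h.1 t ht
  simp only [Affine.eval, pt, h1, h2]
  ring

lemma gap_ends_mem_arcs (h : GapChain p gaps q) {g : ℝ × ℝ} (hg : g ∈ gaps) :
    g.1 ∈ (Vertex.free dl dr p q gaps).arcs ∧ g.2 ∈ (Vertex.free dl dr p q gaps).arcs := by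
  obtain ⟨h1, h2, h3⟩ := h.bounds g hg
  have h4 := EReal.coe_le_coe_iff.2 h2.le
  exact ⟨⟨h1, h4.trans h3, fun k hk => (h.ends_notMem g hg k hk).1⟩,
    ⟨h1.trans h4, h3, fun k hk => (h.ends_notMem g hg k hk).2⟩⟩

lemma left_end_mem_arcs {p : ℝ} (h : GapChain p gaps q) :
    p ∈ (Vertex.free dl dr p q gaps).arcs :=
  ⟨le_rfl, h.le, fun g hg h' => (EReal.coe_le_coe_iff.1 (h.bounds g hg).1).not_gt h'.1⟩

lemma right_end_mem_arcs {q : ℝ} (h : GapChain p gaps q) :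
    q ∈ (Vertex.free dl dr p q gaps).arcs :=
  ⟨h.le, le_rfl, fun g hg h' => (EReal.coe_le_coe_iff.1 (h.bounds g hg).2.2).not_gt h'.2⟩

/-- The three cases are the possible positions of s: on an arc, in a gap, or beyond an incoming
right tangent. -/
lemma leftPart_free (hε : 0 < ε) (hv : (Vertex.free dl dr p q gaps).Valid ε)
    (hA : ∀ t ∈ (Vertex.free dl dr p q gaps).arcs, f t = β.eval (pt t))
    (hready : dl = Dir.R → ∀ p' : ℝ, p = p' → Ready f ε p' (β.eval (upperPt ε p')))
    (hx : x ∈ (Vertex.free dl dr p q gaps).region ε) (hsx : s ≤ x.1) (hxt : x.1 ≤ t)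
    (hst : t - s ≤ 2 * ε) (h : x.2 = (s + t) * x.1 - s * t) (hp : p ≤ s ∨ dl = Dir.R) :
    LeftPart f ε β s t x.1 := by
  obtain ⟨hp1, hq1, hchain, hlen, hpR, -, -⟩ := hv
  obtain ⟨hstrip, hpx, hxq, hgap⟩ := hx
  by_cases hps : p ≤ s
  · have hsq : (s : EReal) ≤ q :=
      (EReal.coe_le_coe_iff.2 (le_foot_of_chord hε hstrip hsx hst h dr)).trans hxq
    by_cases hs : ∀ g ∈ gaps, s ∉ Ioo g.1 g.2
    · exact leftPart_of_arc (hA s ⟨hps, hsq, hs⟩) hsx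
    · push Not at hs
      obtain ⟨g, hg, hsg⟩ := hs
      have hends := gap_ends_mem_arcs (dl := dl) (dr := dr) hchain hg
      refine leftPart_of_gap (hA _ hends.1) (hA _ hends.2) (hlen g hg) hsg.1 hsg.2 hsx hxt
        fun hx => ?_
      rw [← h]
      exact hgap g hg (hsg.1.le.trans hsx) hx
  · obtain rfl : dl = Dir.R := hp.resolve_left hps
    lift p to ℝ using ⟨hp1, hpR rfl⟩
    have hpx' : p ≤ foot Dir.R ε x := EReal.coe_le_coe_iff.1 hpx
    obtain ⟨h1, h2⟩ := right_of_tangent hstrip hpx'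
    refine leftPart_of_ready hε (hready rfl p rfl) (hA p (left_end_mem_arcs hchain))
      (le_of_not_ge fun h => hps (EReal.coe_le_coe_iff.2 h))
      (hpx'.trans (foot_le_of_chord hε hstrip hxt hst h _)) hst h1 ?_
    rw [h] at h2
    linarith

lemma rightPart_free (hε : 0 < ε) (hv : (Vertex.free dl dr p q gaps).Valid ε)
    (hA : ∀ t ∈ (Vertex.free dl dr p q gaps).arcs, f t = β.eval (pt t))
    (hready : dr = Dir.L → ∀ q' : ℝ, q = q' →
      Ready (fun v => f (-v)) ε (-q') (β.eval (q' + ε, (q' + ε) ^ 2 + ε ^ 2)))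
    (hx : x ∈ (Vertex.free dl dr p q gaps).region ε) (hsx : s ≤ x.1) (hxt : x.1 ≤ t)
    (hst : t - s ≤ 2 * ε) (h : x.2 = (s + t) * x.1 - s * t) (hq : t ≤ q ∨ dr = Dir.L) :
    RightPart f ε β s t x.1 := by
  obtain ⟨hp1, hq1, hchain, hlen, -, hqL, -⟩ := hv
  obtain ⟨hstrip, hpx, hxq, hgap⟩ := hx
  by_cases htq : t ≤ q
  · have hpt : p ≤ (t : EReal) :=
      hpx.trans (EReal.coe_le_coe_iff.2 (foot_le_of_chord hε hstrip hxt hst h dl))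
    by_cases ht : ∀ g ∈ gaps, t ∉ Ioo g.1 g.2
    · exact rightPart_of_arc (hA t ⟨hpt, htq, ht⟩) hxt
    · push Not at ht
      obtain ⟨g, hg, htg⟩ := ht
      have hends := gap_ends_mem_arcs (dl := dl) (dr := dr) hchain hg
      refine rightPart_of_gap (hA _ hends.1) (hA _ hends.2) (hlen g hg) htg.1 htg.2 hsx hxt
        fun hx => ?_
      rw [← h]
      exact hgap g hg hx (hxt.trans htg.2.le)
  · obtain rfl : dr = Dir.L := hq.resolve_left htq
    lift q to ℝ using ⟨hqL rfl, hq1⟩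
    have hxq' : foot Dir.L ε x ≤ q := EReal.coe_le_coe_iff.1 hxq
    obtain ⟨h1, h2⟩ := left_of_tangent hstrip hxq'
    refine rightPart_of_ready hε (hready rfl q rfl) (hA q (right_end_mem_arcs hchain))
      ((le_foot_of_chord hε hstrip hsx hst h _).trans hxq')
      (le_of_not_ge fun h => htq (EReal.coe_le_coe_iff.2 h)) hst h1 ?_
    rw [h] at h2
    linarith

/-- Every point of a linearity domain that reaches the upper boundary lies on a chord whose ends
do not leave the domain through its outgoing borders. -/
lemma exists_chord_free (hε : 0 < ε) (hv : (Vertex.free dl dr p q gaps).Valid ε)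
    (hx : x ∈ (Vertex.free dl dr p q gaps).region ε) :
    ∃ s t : ℝ, s ≤ x.1 ∧ x.1 ≤ t ∧ t - s ≤ 2 * ε ∧ x.2 = (s + t) * x.1 - s * t ∧
      (p ≤ s ∨ dl = Dir.R) ∧ (t ≤ q ∨ dr = Dir.L) := by
  obtain ⟨hp1, hq1, -, -, -, -, hLR⟩ := hv
  obtain ⟨hstrip, hpx, hxq, -⟩ := hx
  set δ := √(x.2 - x.1 ^ 2) with hδ
  have h2 : 0 ≤ δ := Real.sqrt_nonneg _
  have h3 : δ ^ 2 = x.2 - x.1 ^ 2 := Real.sq_sqrt (by linarith [hstrip.1])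
  have hδε : δ ≤ ε := by nlinarith [hstrip.2]
  -- The chord with ends x₁ ± δ is kept unless it leaves through an outgoing tangent; then that end
  -- is moved to the foot of the tangent. If both tangents are outgoing, q - p ≥ 2ε keeps the other
  -- end inside.
  by_cases hl : p ≤ (x.1 - δ : ℝ) ∨ dl = Dir.R
  · by_cases hr : (x.1 + δ : ℝ) ≤ q ∨ dr = Dir.L
    · exact ⟨x.1 - δ, x.1 + δ, by linarith, by linarith, by linarith, by linarith, hl, hr⟩
    · push Not at hr
      obtain rfl : dr = Dir.R := by cases dr <;> simp_all
      lift q to ℝ using ⟨ne_top_of_lt hr.1, hq1⟩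
      obtain ⟨s, h4, h5, h6, h7⟩ := exists_chord_to_right hstrip (EReal.coe_le_coe_iff.1 hxq) hε
        (EReal.coe_lt_coe_iff.1 hr.1)
      refine ⟨s, q, h4, h5, h6, h7, ?_, Or.inl le_rfl⟩
      cases dl
      · exact Or.inr rfl
      · refine Or.inl ?_
        have := hLR rfl rfl
        induction p with
        | bot => exact bot_le
        | top => exact absurd rfl hp1
        | coe p =>
          rw [← EReal.coe_add, EReal.coe_le_coe_iff] at this
          exact EReal.coe_le_coe_iff.2 (by linarith)
  · push Not at hl
    obtain rfl : dl = Dir.L := by cases dl <;> simp_all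
    lift p to ℝ using ⟨hp1, ne_bot_of_gt hl.1⟩
    obtain ⟨t, h4, h5, h6, h7⟩ := exists_chord_from_left hstrip (EReal.coe_le_coe_iff.1 hpx) hε
      (EReal.coe_lt_coe_iff.1 hl.1)
    refine ⟨p, t, h4, h5, h6, h7, Or.inl le_rfl, ?_⟩
    cases dr
    · refine Or.inl (le_trans ?_ (hLR rfl rfl))
      rw [← EReal.coe_add, EReal.coe_le_coe_iff]
      linarith
    · exact Or.inr rfl

lemma exists_piece_free (hε : 0 < ε) (hv : (Vertex.free dl dr p q gaps).Valid ε)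
    (hA : ∀ t ∈ (Vertex.free dl dr p q gaps).arcs, f t = β.eval (pt t))
    (hl : dl = Dir.R → ∀ p' : ℝ, p = p' → Ready f ε p' (β.eval (upperPt ε p')))
    (hr : dr = Dir.L → ∀ q' : ℝ, q = q' →
      Ready (fun v => f (-v)) ε (-q') (β.eval (q' + ε, (q' + ε) ^ 2 + ε ^ 2)))
    (hx : x ∈ (Vertex.free dl dr p q gaps).region ε) :
    ∃ φ, Piece f ε φ x (β.eval x) := by
  obtain ⟨s, t, hsx, hxt, hst, h, hp, hq⟩ := exists_chord_free hε hv hx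
  exact (leftPart_free hε hv hA hl hx hsx hxt hst h hp).exists_piece
    (rightPart_free hε hv hA hr hx hsx hxt hst h hq)
    (pow_le_pow_left₀ (by linarith) hst 2) h

lemma gap_below_upper {a b y : ℝ} (ha : a ≤ y) (hb : y ≤ b) (h : b - a ≤ 2 * ε) :
    (a + b) * y - a * b ≤ y ^ 2 + ε ^ 2 := by
  nlinarith [sq_nonneg (2 * y - a - b), mul_nonneg (sub_nonneg.2 ha) (sub_nonneg.2 hb)]

/-- The outgoing tangent extends to the chord over [q - 2ε, q], so the chord construction applies at
the tangency point. The left end of this chord is in [p, q] when `dl = L`; otherwise the incoming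
tangent supplies what is needed. -/
lemma ready_out_right (hε : 0 < ε) {q : ℝ} (hv : (Vertex.free dl Dir.R p q gaps).Valid ε)
    (hA : ∀ t ∈ (Vertex.free dl Dir.R p q gaps).arcs, f t = β.eval (pt t))
    (hl : dl = Dir.R → ∀ p' : ℝ, p = p' → Ready f ε p' (β.eval (upperPt ε p'))) :
    Ready f ε q (β.eval (upperPt ε q)) := by
  obtain ⟨hp1, -, hchain, hlen, -, -, hLR⟩ := id hv
  have hfR : foot Dir.R ε (upperPt ε q) = q := by rw [foot_R]; simp [upperPt]
  have hfL : foot Dir.L ε (upperPt ε q) = q - 2 * ε := by rw [foot_L]; simp [upperPt]; ring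
  have hpL : dl = Dir.L → p ≤ ((q - 2 * ε : ℝ) : EReal) := fun h => by
    have := hLR h rfl
    induction p with
    | bot => exact bot_le
    | top => exact absurd rfl hp1
    | coe p =>
      rw [← EReal.coe_add, EReal.coe_le_coe_iff] at this
      exact EReal.coe_le_coe_iff.2 (by linarith)
  refine LeftPart.ready hε (hA q (right_end_mem_arcs hchain))
    (leftPart_free hε hv hA hl (x := upperPt ε q) ⟨⟨?_, ?_⟩, ?_, ?_, ?_⟩ ?_ ?_ ?_ ?_ ?_)
  · simp [upperPt, sq_nonneg]
  · simp [upperPt]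
  · cases dl
    · rw [hfR]; exact hchain.le
    · rw [hfL]; exact hpL rfl
  · rw [hfR]
  · exact fun g hg h1 h2 => gap_below_upper h1 h2 (hlen g hg)
  · simp [upperPt]; linarith
  · simp [upperPt, hε.le]
  · linarith
  · simp [upperPt]; ring
  · cases dl
    · exact Or.inr rfl
    · exact Or.inl (hpL rfl)

lemma ready_out_left (hε : 0 < ε) {p : ℝ} (hv : (Vertex.free Dir.L dr p q gaps).Valid ε)
    (hA : ∀ t ∈ (Vertex.free Dir.L dr p q gaps).arcs, f t = β.eval (pt t))
    (hr : dr = Dir.L → ∀ q' : ℝ, q = q' →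
      Ready (fun v => f (-v)) ε (-q') (β.eval (q' + ε, (q' + ε) ^ 2 + ε ^ 2))) :
    Ready (fun v => f (-v)) ε (-p) (β.eval (p + ε, (p + ε) ^ 2 + ε ^ 2)) := by
  obtain ⟨-, hq1, hchain, hlen, -, -, hLR⟩ := id hv
  set y : ℝ × ℝ := (p + ε, (p + ε) ^ 2 + ε ^ 2) with hy
  have hfL : foot Dir.L ε y = p := by rw [foot_L]; simp [hy]
  have hfR : foot Dir.R ε y = p + 2 * ε := by rw [foot_R]; simp [hy]; ring
  have hqR : dr = Dir.R → ((p + 2 * ε : ℝ) : EReal) ≤ q := fun h => by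
    rw [EReal.coe_add]; exact hLR rfl h
  have hR : RightPart f ε β p (p + 2 * ε) y.1 := by
    refine rightPart_free hε hv hA hr (x := y) ⟨⟨?_, ?_⟩, ?_, ?_, ?_⟩ ?_ ?_ ?_ ?_ ?_
    · simp [hy, sq_nonneg]
    · simp [hy]
    · rw [hfL]
    · cases dr
      · rw [hfR]; exact hqR rfl
      · rw [hfL]; exact hchain.le
    · exact fun g hg h1 h2 => gap_below_upper h1 h2 (hlen g hg)
    · simp [hy, hε.le]
    · simp [hy]; linarith
    · linarith
    · simp [hy]; ring
    · cases dr
      · exact Or.inl (hqR rfl)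
      · exact Or.inr rfl
  have h := LeftPart.ready (f := fun v => f (-v)) (β := β.reflect) (q := -p) hε
    (by simpa [Affine.eval_reflect, pt] using hA p (left_end_mem_arcs hchain))
    (by convert hR.reflect using 1 <;> simp [hy] <;> ring)
  convert h using 1
  rw [Affine.eval_reflect, upperPt, hy]
  simp only [Affine.eval]
  ring

end vertex

/-! ### Closed linearity domains -/

/-- Moments are preserved by any concatenation, so the set of attained points is convex; keeping the
values in `A` is what later bounds the oscillation. -/
lemma exists_moments_of_mem_convexHull {f : ℝ → ℝ} {β : Affine} {A : Set ℝ}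
    (hA : ∀ t ∈ A, f t = β.eval (pt t)) {x : ℝ × ℝ} (hx : x ∈ convexHull ℝ (pt '' A)) :
    ∃ φ, (∀ t, φ t ∈ A) ∧ Moments f φ x (β.eval x) := by
  refine convexHull_min (t := {x | ∃ φ, (∀ t, φ t ∈ A) ∧ Moments f φ x (β.eval x)}) ?_ ?_ hx
  · rintro _ ⟨t, ht, rfl⟩
    exact ⟨fun _ => t, fun _ => ht, hA t ht ▸ Moments.const f t⟩
  · rintro y ⟨φ, hφ, hφm⟩ z ⟨χ, hχ, hχm⟩ a b ha hb hab
    obtain rfl : b = 1 - a := by linarith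
    refine ⟨join a φ χ, fun t => ?_, ?_⟩
    · unfold join
      split_ifs
      exacts [hφ _, hχ _]
    · rw [β.eval_combo]
      exact hφm.join hχm ⟨ha, by linarith⟩

/-- Here (φ - p)(φ - q) ≤ 0 pointwise, so one chord serves all subintervals. -/
lemma smallOscillation_of_mem_Icc {f φ : ℝ → ℝ} {x : ℝ × ℝ} {V ε p q : ℝ} (hm : Moments f φ x V)
    (hφ : ∀ t, φ t ∈ Icc p q) (hpq : q - p ≤ 2 * ε) : SmallOscillation ε φ := by
  intro c d hc hcd hd
  refine ⟨p, q, pow_le_pow_left₀ (by linarith [(hφ 0).1, (hφ 0).2]) hpq 2, ?_⟩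
  have hi := hm.intervalIntegrable_chord p q
  have hsub : ∀ a b : ℝ, 0 ≤ a → a ≤ b → b ≤ 1 →
      IntervalIntegrable (fun τ => (φ τ - p) * (φ τ - q)) volume a b := fun a b h0 h1 h2 =>
    hi.mono_set (by
      rw [uIcc_of_le h1, uIcc_of_le zero_le_one]; exact Icc_subset_Icc h0 h2)
  have h1 : chordIntegral φ p q d - chordIntegral φ p q c =
      ∫ τ in c..d, (φ τ - p) * (φ τ - q) :=
    intervalIntegral.integral_interval_sub_left (hsub 0 d le_rfl (hc.trans hcd.le) hd)
      (hsub 0 c le_rfl hc (hcd.le.trans hd))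
  have h2 : ∫ τ in c..d, (φ τ - p) * (φ τ - q) ≤ ∫ τ in c..d, (0 : ℝ) :=
    intervalIntegral.integral_mono_on hcd.le (hsub c d hc hcd.le hd) intervalIntegrable_const
      fun τ _ => mul_nonpos_of_nonneg_of_nonpos (sub_nonneg.2 (hφ τ).1) (sub_nonpos.2 (hφ τ).2)
  simp only [intervalIntegral.integral_zero] at h2
  linarith

/-! ### Optimizers on arbitrary intervals -/

lemma exists_isOptimizer {f φ : ℝ → ℝ} {ε : ℝ} {B : ℝ × ℝ → ℝ} {x : ℝ × ℝ} {l r : ℝ}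
    (hlr : l < r) (hm : Moments f φ x (B x)) (hosc : SmallOscillation ε φ) :
    ∃ φ : ℝ → ℝ, IsOptimizer f ε B x l r φ := by
  have hrl : 0 < r - l := sub_pos.2 hlr
  set χ : ℝ → ℝ := fun t => φ ((t - l) / (r - l)) with hχ
  have hint : ∀ g : ℝ → ℝ, IntervalIntegrable (fun t => g (φ t)) volume 0 1 →
      IntervalIntegrable (fun t => g (χ t)) volume l r := fun g hg =>
    intervalIntegrable_comp_affine hg hlr.ne
  have hpre : ∀ (g : ℝ → ℝ) (c : ℝ),
      ∫ t in l..(l + (r - l) * c), g (χ t) = (r - l) * ∫ t in (0 : ℝ)..c, g (φ t) := fun g c =>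
    integral_comp_affine (fun t => g (φ t)) l r c
  have havg : ∀ g : ℝ → ℝ, ⨍ t in l..r, g (χ t) = ∫ t in (0 : ℝ)..1, g (φ t) := fun g => by
    have := hpre g 1
    rw [mul_one, add_sub_cancel] at this
    rw [interval_average_eq, this, smul_eq_mul, inv_mul_cancel_left₀ hrl.ne']
  have hon : ∀ g : ℝ → ℝ, IntervalIntegrable (fun t => g (φ t)) volume 0 1 →
      IntegrableOn (fun t => g (χ t)) (Icc l r) volume := fun g hg => by
    rw [integrableOn_Icc_iff_integrableOn_Ioc]
    exact (intervalIntegrable_iff_integrableOn_Ioc_of_le hlr.le).1 (hint g hg)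
  refine ⟨χ, ⟨?_, ?_⟩, ?_, ?_, ?_, ?_⟩
  · have h1 := hon (fun v => v) hm.int1
    exact (memLp_two_iff_integrable_sq h1.aestronglyMeasurable).2 (hon (fun v => v ^ 2) hm.int2)
  · intro c d hlc hcd hdr
    have hdc : 0 < d - c := sub_pos.2 hcd
    have hsub : ∀ g : ℝ → ℝ, IntervalIntegrable (fun t => g (φ t)) volume 0 1 →
        ∀ a b : ℝ, l ≤ a → a ≤ b → b ≤ r →
          IntervalIntegrable (fun t => g (χ t)) volume a b := fun g hg a b h0 h1 h2 =>
      (hint g hg).mono_set (by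
        rw [uIcc_of_le h1, uIcc_of_le hlr.le]; exact Icc_subset_Icc h0 h2)
    obtain ⟨s, t, hst, hle⟩ := hosc ((c - l) / (r - l)) ((d - l) / (r - l))
      (div_nonneg (by linarith) hrl.le) (by gcongr) ((div_le_one hrl).2 (by linarith))
    have hq := hm.intervalIntegrable_chord s t
    have h1 : ∫ τ in c..d, (χ τ - s) * (χ τ - t) ≤ 0 := by
      have ec := hpre (fun v => (v - s) * (v - t)) ((c - l) / (r - l))
      have ed := hpre (fun v => (v - s) * (v - t)) ((d - l) / (r - l))
      rw [mul_div_cancel₀ _ hrl.ne', add_sub_cancel] at ec ed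
      have := intervalIntegral.integral_interval_sub_left
        (hsub (fun v => (v - s) * (v - t)) hq l d le_rfl (by linarith) hdr)
        (hsub (fun v => (v - s) * (v - t)) hq l c le_rfl hlc (by linarith))
      rw [← this, ec, ed, ← mul_sub]
      exact mul_nonpos_of_nonneg_of_nonpos hrl.le (sub_nonpos.2 hle)
    have i1 := hsub (fun v => v) hm.int1 c d hlc hcd.le hdr
    have i2 := hsub (fun v => v ^ 2) hm.int2 c d hlc hcd.le hdr
    have hquad : ∀ a b : ℝ, ∫ τ in c..d, (χ τ - a) * (χ τ - b) =
        (∫ τ in c..d, χ τ ^ 2) - (a + b) * (∫ τ in c..d, χ τ) + a * b * (d - c) := by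
      intro a b
      have : (fun τ => (χ τ - a) * (χ τ - b)) = fun τ => χ τ ^ 2 - (a + b) * χ τ + a * b := by
        ext; ring
      rw [this, intervalIntegral.integral_add (i2.sub (i1.const_mul _)) intervalIntegrable_const,
        intervalIntegral.integral_sub i2 (i1.const_mul _),
        intervalIntegral.integral_const_mul, intervalIntegral.integral_const, smul_eq_mul]
      ring
    set m := ⨍ τ in c..d, χ τ with hmdef
    have hm' : ∫ τ in c..d, χ τ = (d - c) * m := by
      rw [hmdef, interval_average_eq, smul_eq_mul, mul_inv_cancel_left₀ hdc.ne']
    rw [interval_average_eq, smul_eq_mul, inv_mul_le_iff₀ hdc]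
    simp only [pow_two (_ - m)]
    rw [hquad, hm']
    rw [hquad, hm'] at h1
    -- With mean m, the chord condition gives variance at most -(m - s)(m - t) = ((t - s)/2)² - (m -
    -- (s + t)/2)².
    have h2 := mul_nonneg hdc.le (sq_nonneg (m - (s + t) / 2))
    have h3 := mul_le_mul_of_nonneg_left hst hdc.le
    linarith
  · rw [← hm.avg1]; exact havg fun v => v
  · rw [← hm.avg2]; exact havg fun v => v ^ 2
  · exact hon f hm.intf
  · rw [← hm.avgf]; exact havg f

/-! ### Optimizers along the graph -/

section graph

variable {f : ℝ → ℝ} {ε : ℝ} {Γ : FoliationGraph} {m : Fin Γ.nE → ℝ → ℝ} {β : Fin Γ.nV → Affine}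

/-- The gluing condition makes the formula of the tangent domain and the affine function of the
linearity domain agree at the tangency point, so `Ready` passes between them. -/
lemma slope_right_eq {b : Affine} {p k : ℝ} {v : Vertex} (hv : VertexConditions f b v)
    (hp : p ∈ v.arcs) (hk : k = deriv f p - Dir.R.sgn * (2 * ε * b.c2)) :
    f p - ε * k = b.eval (upperPt ε p) := by
  obtain ⟨h1, h2⟩ := hv.1 p hp
  simp only [hk, Affine.eval, upperPt, h1, h2, Dir.sgn]
  ring

lemma slope_left_eq {b : Affine} {p k : ℝ} {v : Vertex} (hv : VertexConditions f b v)
    (hp : p ∈ v.arcs) (hk : k = deriv f p - Dir.L.sgn * (2 * ε * b.c2)) :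
    f p + ε * k = b.eval (p + ε, (p + ε) ^ 2 + ε ^ 2) := by
  obtain ⟨h1, h2⟩ := hv.1 p hp
  simp only [hk, Affine.eval, h1, h2, Dir.sgn]
  ring

lemma Edge.eq_of_finish_right {e : Edge} {p : EReal} (h : e.finish = Border.tangent Dir.R p) :
    ∃ ul, e = Edge.tangent Dir.R ul p := by
  cases e with
  | tangent d ul ur => cases d <;> simp [Edge.finish] at h; exact ⟨ul, h ▸ rfl⟩
  | chordal => simp [Edge.finish] at h

lemma Edge.eq_of_finish_left {e : Edge} {p : EReal} (h : e.finish = Border.tangent Dir.L p) :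
    ∃ ur, e = Edge.tangent Dir.L p ur := by
  cases e with
  | tangent d ul ur => cases d <;> simp [Edge.finish] at h; exact ⟨ur, h ▸ rfl⟩
  | chordal => simp [Edge.finish] at h

lemma Vertex.eq_of_out_right {v : Vertex} {p : ℝ} (h : Border.tangent Dir.R p ∈ v.out) :
    ∃ dl pl gaps, v = Vertex.free dl Dir.R pl p gaps := by
  cases v with
  | free dl dr pl q gaps =>
    rcases h with ⟨-, -, h⟩ | ⟨rfl, -, h⟩ | ⟨g, -, h⟩
    · simp at h
    · simp only [Border.tangent.injEq, true_and] at h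
      exact ⟨dl, pl, gaps, by rw [h]⟩
    · simp at h
  | closed p q gaps => obtain ⟨g, -, h⟩ := h; simp at h
  | negInf d => cases d <;> simp [Vertex.out] at h
  | posInf d => cases d <;> simp [Vertex.out] at h

lemma Vertex.eq_of_out_left {v : Vertex} {p : ℝ} (h : Border.tangent Dir.L p ∈ v.out) :
    ∃ dr q gaps, v = Vertex.free Dir.L dr p q gaps := by
  cases v with
  | free dl dr pl q gaps =>
    rcases h with ⟨rfl, -, h⟩ | ⟨rfl, -, h⟩ | ⟨g, -, h⟩
    · simp only [Border.tangent.injEq, true_and] at h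
      exact ⟨dr, q, gaps, by rw [h]⟩
    · simp at h
    · simp at h
  | closed p q gaps => obtain ⟨g, -, h⟩ := h; simp at h
  | negInf d => cases d <;> simp [Vertex.out] at h
  | posInf d => cases d <;> simp [Vertex.out] at h

/-- The incoming right tangent of a linearity domain is the end of a tangent domain. -/
lemma FoliationGraph.IsFoliation.exists_edge_right (hΓ : Γ.IsFoliation ε) {v : Fin Γ.nV}
    {dr : Dir} {p : ℝ} {q : EReal} {gaps : List (ℝ × ℝ)}
    (hv : Γ.vertex v = Vertex.free Dir.R dr p q gaps) :
    ∃ e ul, Γ.edge e = Edge.tangent Dir.R ul p ∧ Γ.tgt e = v := by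
  obtain ⟨e, ⟨he, hf⟩, -⟩ := hΓ.into_unique v (Border.tangent Dir.R p)
    (by rw [hv]; exact Or.inl ⟨rfl, rfl⟩)
  obtain ⟨ul, h⟩ := Edge.eq_of_finish_right hf
  exact ⟨e, ul, h, he⟩

/-- The incoming left tangent of a linearity domain is the end of a tangent domain. -/
lemma FoliationGraph.IsFoliation.exists_edge_left (hΓ : Γ.IsFoliation ε) {v : Fin Γ.nV}
    {dl : Dir} {p : EReal} {q : ℝ} {gaps : List (ℝ × ℝ)}
    (hv : Γ.vertex v = Vertex.free dl Dir.L p q gaps) :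
    ∃ e ur, Γ.edge e = Edge.tangent Dir.L q ur ∧ Γ.tgt e = v := by
  obtain ⟨e, ⟨he, hf⟩, -⟩ := hΓ.into_unique v (Border.tangent Dir.L q)
    (by rw [hv]; exact Or.inr ⟨rfl, rfl⟩)
  obtain ⟨ur, h⟩ := Edge.eq_of_finish_left hf
  exact ⟨e, ur, h, he⟩

lemma ready_in_right (hΓ : Γ.IsFoliation ε) (hL : Γ.LocalConditions f ε m β) {v : Fin Γ.nV}
    {dr : Dir} {p : ℝ} {q : EReal} {gaps : List (ℝ × ℝ)}
    (hv : Γ.vertex v = Vertex.free Dir.R dr p q gaps)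
    (h : ∀ e ul, Γ.edge e = Edge.tangent Dir.R ul p → Ready f ε p (f p - ε * m e p)) :
    Ready f ε p ((β v).eval (upperPt ε p)) := by
  obtain ⟨e, ul, he, rfl⟩ := hΓ.exists_edge_right hv
  have hval := hΓ.vertex_valid (Γ.tgt e)
  rw [hv] at hval
  rw [← slope_right_eq (hL.vertex_cond _) (by rw [hv]; exact left_end_mem_arcs hval.2.2.1)
    (hL.glue_finish e Dir.R p (by rw [he]; rfl))]
  exact h e ul he

lemma ready_in_left (hΓ : Γ.IsFoliation ε) (hL : Γ.LocalConditions f ε m β) {v : Fin Γ.nV}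
    {dl : Dir} {p : EReal} {q : ℝ} {gaps : List (ℝ × ℝ)}
    (hv : Γ.vertex v = Vertex.free dl Dir.L p q gaps)
    (h : ∀ e ur, Γ.edge e = Edge.tangent Dir.L q ur →
      Ready (fun v => f (-v)) ε (-q) (f q + ε * m e q)) :
    Ready (fun v => f (-v)) ε (-q) ((β v).eval (q + ε, (q + ε) ^ 2 + ε ^ 2)) := by
  obtain ⟨e, ur, he, rfl⟩ := hΓ.exists_edge_left hv
  have hval := hΓ.vertex_valid (Γ.tgt e)
  rw [hv] at hval
  rw [← slope_left_eq (hL.vertex_cond _) (by rw [hv]; exact right_end_mem_arcs hval.2.2.1)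
    (hL.glue_finish e Dir.L q (by rw [he]; rfl))]
  exact h e ur he

lemma EdgeConditions.hasDerivAt_right {m : ℝ → ℝ} {ul ur : EReal} (hε : 0 < ε)
    (h : EdgeConditions f ε m (Edge.tangent Dir.R ul ur)) {v : ℝ} (hl : ul < v) (hr : v < ur) :
    HasDerivAt m ((deriv f v - m v) / ε) v := by
  obtain ⟨h1, h2, -⟩ := h.2.1 v hl hr
  refine h1.hasDerivAt.congr_deriv ?_
  rw [eq_div_iff hε.ne']
  simp only [Dir.sgn] at h2
  linarith

lemma EdgeConditions.hasDerivAt_left {m : ℝ → ℝ} {ul ur : EReal} (hε : 0 < ε)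
    (h : EdgeConditions f ε m (Edge.tangent Dir.L ul ur)) {v : ℝ} (hl : ul < (-v : ℝ))
    (hr : (-v : ℝ) < ur) :
    HasDerivAt (fun v => -m (-v)) ((deriv (fun v => f (-v)) v - -m (-v)) / ε) v := by
  obtain ⟨h1, h2, -⟩ := h.2.1 (-v) hl hr
  refine ((h1.hasDerivAt.comp v (hasDerivAt_neg v)).neg).congr_deriv ?_
  rw [eq_div_iff hε.ne', deriv_comp_neg]
  simp only [Dir.sgn] at h2
  linarith

/-- Optimizers on the tangents of right tangent domains. -/
lemma ready_right (hε : 0 < ε) (hf : Differentiable ℝ f) (hexp : SubExp ε f)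
    (hexp' : SubExp ε (deriv f)) (hΓ : Γ.IsFoliation ε) (hL : Γ.LocalConditions f ε m β)
    (e : Fin Γ.nE) : ∀ ul ur : EReal, Γ.edge e = Edge.tangent Dir.R ul ur →
      ∀ u : ℝ, ul ≤ u → u ≤ ur → Ready f ε u (f u - ε * m e u) := by
  -- Induction on left ends of tangent domains, well founded because there are finitely many edges;
  -- the value for chordal edges is arbitrary.
  let key : Fin Γ.nE → EReal := fun e => match Γ.edge e with
    | .tangent _ ul _ => ul
    | .chordal _ _ _ _ => ⊥
  have hkey : ∀ {e d ul ur}, Γ.edge e = Edge.tangent d ul ur → key e = ul := fun h => by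
    simp only [key, h]
  have wf : WellFounded fun e e' => key e < key e' :=
    @Finite.wellFounded_of_trans_of_irrefl _ _ _ ⟨fun _ _ _ => lt_trans⟩ ⟨fun _ => lt_irrefl _⟩
  induction e using wf.induction with
  | _ e ih =>
    intro ul ur he u hul hur
    have hc := hL.edge_cond e
    rw [he] at hc
    have hlt : ul < ur := by have := hΓ.edge_valid e; rwa [he] at this
    induction ul with
    | top => exact absurd hlt not_top_lt
    | bot =>
      refine ready_of_tangents_from_bot hε hf hexp hexp' (hc.1.mono fun v hv =>
        ⟨bot_le, (EReal.coe_le_coe_iff.2 hv).trans hur⟩) (fun v hv =>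
        hc.hasDerivAt_right hε (EReal.bot_lt_coe v) ((EReal.coe_lt_coe_iff.2 hv).trans_le hur))
        fun v hv => hc.2.2.1 rfl rfl v ((EReal.coe_le_coe_iff.2 hv).trans hur)
    | coe w =>
      refine Ready.of_tangents hε hf (EReal.coe_le_coe_iff.1 hul) (hc.1.mono fun v hv =>
        ⟨EReal.coe_le_coe_iff.2 hv.1, (EReal.coe_le_coe_iff.2 hv.2).trans hur⟩) (fun v hv =>
        hc.hasDerivAt_right hε (EReal.coe_lt_coe_iff.2 hv.1)
          ((EReal.coe_lt_coe_iff.2 hv.2).trans_le hur)) ?_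
      have hs : (Γ.edge e).start = Border.tangent Dir.R w := by rw [he]; rfl
      have hout := hΓ.start_mem e
      rw [hs] at hout
      obtain ⟨dl, p, gaps, hv⟩ := Vertex.eq_of_out_right hout
      have hval := hΓ.vertex_valid (Γ.src e)
      have hA := (hL.vertex_cond (Γ.src e)).trace
      have hw : w ∈ (Γ.vertex (Γ.src e)).arcs := by
        rw [hv] at hval ⊢; exact right_end_mem_arcs hval.2.2.1
      rw [slope_right_eq (hL.vertex_cond _) hw (hL.glue_start e Dir.R w hs)]
      rw [hv] at hval hA
      refine ready_out_right hε hval hA ?_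
      -- An incoming right tangent at the source vertex has foot p' ≤ w and ends a domain that
      -- starts strictly left of p', so the induction hypothesis applies.
      rintro rfl p' rfl
      refine ready_in_right hΓ hL hv fun e' ul' he' => ?_
      have hlt' : ul' < p' := by have := hΓ.edge_valid e'; rwa [he'] at this
      exact ih e' (by rw [hkey he, hkey he']; exact hlt'.trans_le hval.2.2.1.le) ul' p' he' p'
        hlt'.le le_rfl

/-- Under reflection f becomes f(-·) and a left slope m becomes the right slope -m(-·); the integral
from infinity turns into the one from -∞. -/
lemma neg_slope_eq {m : ℝ → ℝ} {ul : EReal}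
    (h : EdgeConditions f ε m (Edge.tangent Dir.L ul ⊤)) {v : ℝ} (hv : ul ≤ (-v : ℝ)) :
    -m (-v) = ε⁻¹ * Real.exp (-v / ε) *
      ∫ t in Iic v, deriv (fun v => f (-v)) t * Real.exp (t / ε) := by
  rw [h.2.2.2 rfl rfl (-v) hv, ← mul_neg]
  congr 1
  have := integral_comp_neg_Iic v (fun t => -(deriv f t * Real.exp (-t / ε)))
  rw [integral_Ici_eq_integral_Ioi, ← integral_neg, ← this]
  simp [deriv_comp_neg]

/-- Optimizers on the tangents of left tangent domains. -/
lemma ready_left (hε : 0 < ε) (hf : Differentiable ℝ f) (hexp : SubExp ε f)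
    (hexp' : SubExp ε (deriv f)) (hΓ : Γ.IsFoliation ε) (hL : Γ.LocalConditions f ε m β)
    (e : Fin Γ.nE) : ∀ ul ur : EReal, Γ.edge e = Edge.tangent Dir.L ul ur →
      ∀ u : ℝ, ul ≤ u → u ≤ ur → Ready (fun v => f (-v)) ε (-u) (f u + ε * m e u) := by
  have hfn : Differentiable ℝ fun v => f (-v) := by fun_prop
  have hexpn : SubExp ε (deriv fun v => f (-v)) := by
    have : (deriv fun v => f (-v)) = fun v => (-1) * deriv f (-v) := by
      ext v; rw [deriv_comp_neg]; ring
    rw [this]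
    exact hexp'.neg.const_mul (-1)
  -- For left tangents the order is reversed: the induction goes from larger right ends to smaller
  -- ones.
  let key : Fin Γ.nE → EReal := fun e => match Γ.edge e with
    | .tangent _ _ ur => ur
    | .chordal _ _ _ _ => ⊥
  have hkey : ∀ {e d ul ur}, Γ.edge e = Edge.tangent d ul ur → key e = ur := fun h => by
    simp only [key, h]
  have wf : WellFounded fun e e' => key e' < key e :=
    @Finite.wellFounded_of_trans_of_irrefl _ _ _ ⟨fun _ _ _ h h' => lt_trans h' h⟩
      ⟨fun _ => lt_irrefl _⟩
  induction e using wf.induction with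
  | _ e ih =>
    intro ul ur he u hul hur
    have hc := hL.edge_cond e
    rw [he] at hc
    have hlt : ul < ur := by have := hΓ.edge_valid e; rwa [he] at this
    have hval : f u + ε * m e u = f (- -u) - ε * -m e (- -u) := by rw [neg_neg]; ring
    rw [hval]
    induction ur with
    | bot => exact absurd hlt not_lt_bot
    | top =>
      have hle : ∀ v ≤ -u, ul ≤ (-v : ℝ) := fun v hv =>
        hul.trans (EReal.coe_le_coe_iff.2 (by linarith))
      refine ready_of_tangents_from_bot (M := fun v => -m e (-v)) hε hfn hexp.neg hexpn
        (hc.1.comp continuousOn_neg fun v hv => ⟨hle v hv, le_top⟩).neg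
        (fun v hv => hc.hasDerivAt_left hε (hul.trans_lt (EReal.coe_lt_coe_iff.2 (by linarith)))
          (EReal.coe_lt_top _)) fun v hv => neg_slope_eq hc (hle v hv)
    | coe w =>
      have huw := EReal.coe_le_coe_iff.1 hur
      refine Ready.of_tangents (M := fun v => -m e (-v)) (u₁ := -w) hε hfn (by linarith)
        (hc.1.comp continuousOn_neg fun v hv => ⟨hul.trans (EReal.coe_le_coe_iff.2 ?_),
          EReal.coe_le_coe_iff.2 ?_⟩).neg
        (fun v hv => hc.hasDerivAt_left hε (hul.trans_lt (EReal.coe_lt_coe_iff.2 ?_))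
          (EReal.coe_lt_coe_iff.2 ?_)) ?_
      · linarith [hv.2]
      · linarith [hv.1]
      · linarith [hv.2]
      · linarith [hv.1]
      have hval : f (- -w) - ε * -m e (- -w) = f w + ε * m e w := by rw [neg_neg]; ring
      rw [hval]
      have hs : (Γ.edge e).start = Border.tangent Dir.L w := by rw [he]; rfl
      have hout := hΓ.start_mem e
      rw [hs] at hout
      obtain ⟨dr, q, gaps, hv⟩ := Vertex.eq_of_out_left hout
      have hval := hΓ.vertex_valid (Γ.src e)
      have hA := (hL.vertex_cond (Γ.src e)).trace
      have hw : w ∈ (Γ.vertex (Γ.src e)).arcs := by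
        rw [hv] at hval ⊢; exact left_end_mem_arcs hval.2.2.1
      rw [slope_left_eq (hL.vertex_cond _) hw (hL.glue_start e Dir.L w hs)]
      rw [hv] at hval hA
      refine ready_out_left hε hval hA ?_
      rintro rfl q' rfl
      refine ready_in_left hΓ hL hv fun e' ur' he' => ?_
      have hlt' : q' < ur' := by have := hΓ.edge_valid e'; rwa [he'] at this
      exact ih e' (by rw [hkey he, hkey he']; exact hval.2.2.1.le.trans_lt hlt') q' ur' he' q'
        le_rfl hlt'.le

lemma exists_optimizer_vertex (hε : 0 < ε) (hf : Differentiable ℝ f) (hexp : SubExp ε f)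
    (hexp' : SubExp ε (deriv f)) (hΓ : Γ.IsFoliation ε) (hL : Γ.LocalConditions f ε m β)
    (v : Fin Γ.nV) {x : ℝ × ℝ} (hx : x ∈ (Γ.vertex v).region ε) :
    ∃ φ, Moments f φ x ((β v).eval x) ∧ SmallOscillation ε φ := by
  have hval := hΓ.vertex_valid v
  have hA := (hL.vertex_cond v).trace
  cases hv : Γ.vertex v with
  | free dl dr p q gaps =>
    rw [hv] at hx hval hA
    obtain ⟨φ, hφ⟩ := exists_piece_free hε hval hA (fun h p' h' => by
        subst h h'
        exact ready_in_right hΓ hL hv fun e ul he => by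
          have hlt : ul < p' := by have := hΓ.edge_valid e; rwa [he] at this
          exact ready_right hε hf hexp hexp' hΓ hL e ul p' he p' hlt.le le_rfl)
      (fun h q' h' => by
        subst h h'
        exact ready_in_left hΓ hL hv fun e ur he => by
          have hlt : q' < ur := by have := hΓ.edge_valid e; rwa [he] at this
          exact ready_left hε hf hexp hexp' hΓ hL e q' ur he q' le_rfl hlt.le) hx
    exact ⟨φ, hφ.toMoments, hφ.osc⟩
  | closed p q gaps =>
    rw [hv] at hx hval hA
    obtain ⟨φ, h1, h2⟩ := exists_moments_of_mem_convexHull hA hx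
    -- The arcs of a closed domain lie in [p, q] with q - p < 2ε, so the order of the values plays
    -- no role.
    exact ⟨φ, h2, smallOscillation_of_mem_Icc h2 (fun t => ⟨(h1 t).1, (h1 t).2.1⟩) hval.2.le⟩
  | negInf d => rw [hv] at hx; exact absurd hx (notMem_empty x)
  | posInf d => rw [hv] at hx; exact absurd hx (notMem_empty x)

lemma on_right_tangent (hε : 0 < ε) {x : ℝ × ℝ} (hx : x ∈ strip ε) :
    foot Dir.R ε x - ε ≤ x.1 ∧ x.1 ≤ foot Dir.R ε x ∧
      x.2 = (2 * foot Dir.R ε x - 2 * ε) * x.1 - foot Dir.R ε x * (foot Dir.R ε x - 2 * ε) := by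
  have h0 := Real.sqrt_nonneg (x.1 ^ 2 + ε ^ 2 - x.2)
  have h1 := Real.sq_sqrt (show 0 ≤ x.1 ^ 2 + ε ^ 2 - x.2 by linarith [hx.2])
  have h2 := strip_sqrt_le hε hx
  rw [foot_R]
  exact ⟨by linarith, by linarith, by linarith⟩

lemma exists_optimizer_edge (hε : 0 < ε) (hf : Differentiable ℝ f) (hexp : SubExp ε f)
    (hexp' : SubExp ε (deriv f)) (hΓ : Γ.IsFoliation ε) (hL : Γ.LocalConditions f ε m β)
    (e : Fin Γ.nE) {x : ℝ × ℝ} {y : ℝ} (hy : EdgeValue f ε (m e) (Γ.edge e) x y) :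
    ∃ φ, Moments f φ x y ∧ SmallOscillation ε φ := by
  cases he : Γ.edge e with
  | tangent d ul ur =>
    rw [he] at hy
    obtain ⟨⟨hx, h1, h2⟩, rfl⟩ := hy
    cases d with
    | R =>
      have hr := ready_right hε hf hexp hexp' hΓ hL e ul ur he _ h1 h2
      obtain ⟨h3, h4, h5⟩ := on_right_tangent hε hx
      obtain ⟨φ, hφ⟩ := hr.exists_piece hε h3 h4 h5 rfl
      exact ⟨φ, hφ.toMoments, hφ.osc⟩
    | L =>
      have hr := ready_left hε hf hexp hexp' hΓ hL e ul ur he _ h1 h2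
      have hfoot : foot Dir.R ε (-x.1, x.2) = -foot Dir.L ε x := by
        rw [foot_R, foot_L, neg_sq]; ring
      obtain ⟨h3, h4, h5⟩ := on_right_tangent (x := (-x.1, x.2)) hε (by simpa [strip] using hx)
      rw [hfoot] at h3 h4 h5
      obtain ⟨φ, hφ⟩ := hr.exists_piece (m := -m e (foot Dir.L ε x)) hε h3 h4 h5
        (by rw [neg_neg]; ring)
      have := hφ.reflect
      simp only [neg_neg] at this
      have h6 := this.congr (y := x) rfl (W := m e (foot Dir.L ε x) * (x.1 - foot Dir.L ε x) +
        f (foot Dir.L ε x)) (by ring)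
      exact ⟨_, h6.toMoments, h6.osc⟩
  | chordal a b lbot ltop =>
    have hval := hΓ.edge_valid e
    rw [he] at hy hval
    obtain ⟨l, hl, s, hs, rfl, rfl⟩ := hy
    obtain ⟨h0, -, h2, h3, -⟩ := hval
    have h4 := h3 l hl
    obtain ⟨φ, hφ⟩ := exists_piece_chord f (ε := ε) (a := a l) (b := b l)
      (by linarith [hl.1]) (by linarith [hl.2]) hs
    exact ⟨φ, hφ.toMoments, hφ.osc⟩

end graph

end

end BMOBellman

theorem mainTheorem3 (f : ℝ → ℝ) (epsInf ε : ℝ)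
    (hreg : BMOBellman.RegularityCondition f)
    (hsum : BMOBellman.SummabilityCondition f epsInf)
    (hε : 0 < ε) (hlt : ε < epsInf)
    (Γ : BMOBellman.FoliationGraph) (hΓ : Γ.Admissible f ε)
    (B : ℝ × ℝ → ℝ) (hB : Γ.Generates f ε B)
    (x : ℝ × ℝ) (hx : x ∈ BMOBellman.strip ε) (l r : ℝ) (hlr : l < r) :
    ∃ φ : ℝ → ℝ, BMOBellman.IsOptimizer f ε B x l r φ := by
  have hf : Differentiable ℝ f := hreg.1.differentiable (by norm_num)
  have hf' : Differentiable ℝ (deriv f) := by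
    have h : ContDiff ℝ (1 + 1) f := by simpa [one_add_one_eq_two] using hreg.1
    exact (contDiff_succ_iff_deriv.1 h).2.2.differentiable (by norm_num)
  have hexp' : BMOBellman.SubExp ε (deriv f) :=
    BMOBellman.SubExp.of_deriv hε hf' (BMOBellman.subExp_deriv_deriv hε hlt hsum)
  have hexp : BMOBellman.SubExp ε f := BMOBellman.SubExp.of_deriv hε hf hexp'
  obtain ⟨m, β, hL, hval⟩ := hB
  suffices h : ∃ φ, BMOBellman.Moments f φ x (B x) ∧ BMOBellman.SmallOscillation ε φ by
    obtain ⟨φ, hφ, hosc⟩ := h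
    exact BMOBellman.exists_isOptimizer hlr hφ hosc
  rcases hval x hx with ⟨v, hxv, hy⟩ | ⟨e, hy⟩
  · rw [hy]
    exact BMOBellman.exists_optimizer_vertex hε hf hexp hexp' hΓ.1 hL v hxv
  · exact BMOBellman.exists_optimizer_edge hε hf hexp hexp' hΓ.1 hL e hy
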